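/- Let $M_d$ denote the algebra of $d\times d$ complex matrices (with $M_0=0$), and let $nM_d$ denote the direct sum of $n$ copies of $M_d$. Let $G\le S_8$ be the subgroup generated by $$(5,7)(6,8),\quad (2,3,5)(4,7,6),\quad (1,2)(3,4)(5,6)(7,8),\quad (1,5)(2,6)(3,7)(4,8),$$ and let $H\le S_{14}$ be the subgroup generated by $$(1,2,3,4,5,6,7)(14,13,12,11,10,9,8),\quad (1,4,7,9,14,11,8,6)(2,5,13,10).$$ Both groups have order $1344$. For $k\ge 1$ let $\mathfrak A_G^{(k)}=\mathrm{End}_G\big((\mathbb C^{8})^{\otimes k}\big)$ and $\mathfrak A_H^{(k)}=\mathrm{End}_H\big((\mathbb C^{14})^{\otimes k}\big)$ be the centralizer algebras of the $k$-fold tensor powers (with diagonal action) of the natural permutation representations of $G$ on $\mathbb C^8$ and of $H$ on $\mathbb C^{14}$. Put \begin{align*} a_{G,k}&=\tfrac{2^{3k}}{1344}+\tfrac{2^{2k}}{32}+\tfrac{7}{24}2^{k}+\tfrac27, & b_{G,k}&=c_{G,k}=\tfrac{2^{3k}}{448}-\tfrac{2^{2k}}{32}+\tfrac{2^{k}}{8}-\tfrac17,\\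 d_{G,k}&=\tfrac{2^{3k}}{224}+\tfrac{2^{2k}}{16}-\tfrac27, & e_{G,k}&=g_{G,k}=\tfrac{2^{3k}}{192}-\tfrac{2^{2k}}{32}+\tfrac{2^{k}}{24},\\ f_{G,k}&=\tfrac{2^{3k}}{168}-\tfrac{2^k}{6}+\tfrac27, & h_{G,k}&=\tfrac{2^{3k}}{192}+\tfrac{3}{32}2^{2k}+\tfrac{7}{24}2^{k},\\ i_{G,k}&=\tfrac{2^{3k}}{96}+\tfrac{2^{2k}}{16}-\tfrac{2^k}{6}, & j_{G,k}&=\tfrac{2^{3k}}{64}-\tfrac{3}{32}2^{2k}+\tfrac{2^{k}}{8},\\ l_{G,k}&=\tfrac{2^{3k}}{64}+\tfrac{2^{2k}}{32}-\tfrac{2^{k}}{8}, \end{align*} and \begin{align*} a_{H,k}&=2^k\big(\tfrac{7^k}{1344}+\tfrac{7}{192}3^k+\tfrac{37}{96}\big), & b_{H,k}&=c_{H,k}=2^k\big(\tfrac{7^k}{448}-\tfrac{3^k}{64}+\tfrac{1}{32}\big),\\ d_{H,k}&=2^k\big(\tfrac{7^k}{224}+\tfrac{3}{32}3^k+\tfrac{3}{16}\big),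 & e_{H,k}&=2^k\big(\tfrac{7^k}{192}+\tfrac{3^k}{192}-\tfrac{5}{96}\big),\\ f_{H,k}&=2^k\big(\tfrac{7^k}{168}+\tfrac{3^k}{24}-\tfrac16\big), & g_{H,k}&=2^k\big(\tfrac{7^k}{192}+\tfrac{17}{192}3^k+\tfrac{19}{96}\big),\\ h_{H,k}&=2^k\big(\tfrac{7^k}{192}-\tfrac{7}{192}3^k+\tfrac{7}{96}\big), & i_{H,k}&=2^k\big(\tfrac{7^k}{96}+\tfrac{5}{96}3^k-\tfrac{11}{48}\big),\\ j_{H,k}&=2^k\big(\tfrac{7^k}{64}+\tfrac{3^k}{64}-\tfrac{5}{32}\big), & l_{H,k}&=2^k\big(\tfrac{7^k}{64}-\tfrac{7}{64}3^k+\tfrac{7}{32}\big). \end{align*} For every $k\ge 1$ all these numbers are non-negative integers, and there are isomorphisms of $\mathbb C$-algebras $$\mathfrak A_G^{(k)}\cong M_{a_{G,k}}\oplus 2M_{b_{G,k}}\oplus M_{d_{G,k}}\oplus 2M_{e_{G,k}}\oplus M_{f_{G,k}}\oplus M_{h_{G,k}}\oplus M_{i_{G,k}}\oplus M_{j_{G,k}}\oplus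 M_{l_{G,k}},$$ $$\mathfrak A_H^{(k)}\cong M_{a_{H,k}}\oplus 2M_{b_{H,k}}\oplus M_{d_{H,k}}\oplus M_{e_{H,k}}\oplus M_{f_{H,k}}\oplus M_{g_{H,k}}\oplus M_{h_{H,k}}\oplus M_{i_{H,k}}\oplus M_{j_{H,k}}\oplus M_{l_{H,k}}.$$ In particular, for $k=1$, $\mathfrak A_G^{(1)}\cong 2M_1$ and $\mathfrak A_H^{(1)}\cong 3M_1$. -/

import Mathlib

namespace Order1344

/-- The subgroup of the symmetric group on eight letters generated by
`(5,7)(6,8)`, `(2,3,5)(4,7,6)`, `(1,2)(3,4)(5,6)(7,8)`, `(1,5)(2,6)(3,7)(4,8)`,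
the letter `i` being the element `i - 1` of `Fin 8`. -/
def G : Subgroup (Equiv.Perm (Fin 8)) :=
  Subgroup.closure
    {[4, 6].formPerm * [5, 7].formPerm,
     [1, 2, 4].formPerm * [3, 6, 5].formPerm,
     [0, 1].formPerm * [2, 3].formPerm * [4, 5].formPerm * [6, 7].formPerm,
     [0, 4].formPerm * [1, 5].formPerm * [2, 6].formPerm * [3, 7].formPerm}

/-- The subgroup of the symmetric group on fourteen letters generated by
`(1,2,3,4,5,6,7)(14,13,12,11,10,9,8)` and `(1,4,7,9,14,11,8,6)(2,5,13,10)`,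
the letter `i` being the element `i - 1` of `Fin 14`. -/
def H : Subgroup (Equiv.Perm (Fin 14)) :=
  Subgroup.closure
    {[0, 1, 2, 3, 4, 5, 6].formPerm * [13, 12, 11, 10, 9, 8, 7].formPerm,
     [0, 3, 6, 8, 13, 10, 7, 5].formPerm * [1, 4, 12, 9].formPerm}

/-- The `k`-fold tensor power of a representation `ρ` on `V`: the element `g` acts on
`V ⊗ ⋯ ⊗ V` as `ρ g ⊗ ⋯ ⊗ ρ g`. -/
noncomputable def tensorPowerRep {Γ V : Type*} [Group Γ] [AddCommGroup V] [Module ℂ V]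
    (ρ : Representation ℂ Γ V) (k : ℕ) :
    Representation ℂ Γ (PiTensorProduct ℂ fun _ : Fin k => V) where
  toFun g := PiTensorProduct.map fun _ => ρ g
  map_one' := by
    rw [map_one]
    exact PiTensorProduct.map_one
  map_mul' g h := by
    rw [map_mul]
    exact PiTensorProduct.map_mul (fun _ => ρ g) (fun _ => ρ h)

/-- The centralizer algebra of the `k`-fold tensor power of the permutation representation of a
permutation group `Γ` on `n` letters: all endomorphisms of the tensor power that commute with
the action of every element of `Γ`. -/
noncomputable def centralizerAlgebra {n : ℕ} (Γ : Subgroup (Equiv.Perm (Fin n))) (k : ℕ) :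
    Subalgebra ℂ
      (Module.End ℂ (PiTensorProduct ℂ fun _ : Fin k => MonoidAlgebra ℂ (Fin n))) :=
  Subalgebra.centralizer ℂ
    (Set.range (tensorPowerRep (Representation.ofMulAction ℂ Γ (Fin n)) k))

/-- The direct sum of the full matrix algebras of sizes `d 0, …, d (m - 1)` over `ℂ`.
A block of size `0` is the zero algebra. -/
abbrev MultiMatrix {m : ℕ} (d : Fin m → ℕ) : Type :=
  (i : Fin m) → Matrix (Fin (d i)) (Fin (d i)) ℂ

def aG (k : ℕ) : ℚ := 2 ^ (3 * k) / 1344 + 2 ^ (2 * k) / 32 + 7 / 24 * 2 ^ k + 2 / 7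
def bG (k : ℕ) : ℚ := 2 ^ (3 * k) / 448 - 2 ^ (2 * k) / 32 + 2 ^ k / 8 - 1 / 7
def cG (k : ℕ) : ℚ := 2 ^ (3 * k) / 448 - 2 ^ (2 * k) / 32 + 2 ^ k / 8 - 1 / 7
def dG (k : ℕ) : ℚ := 2 ^ (3 * k) / 224 + 2 ^ (2 * k) / 16 - 2 / 7
def eG (k : ℕ) : ℚ := 2 ^ (3 * k) / 192 - 2 ^ (2 * k) / 32 + 2 ^ k / 24
def fG (k : ℕ) : ℚ := 2 ^ (3 * k) / 168 - 2 ^ k / 6 + 2 / 7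
def gG (k : ℕ) : ℚ := 2 ^ (3 * k) / 192 - 2 ^ (2 * k) / 32 + 2 ^ k / 24
def hG (k : ℕ) : ℚ := 2 ^ (3 * k) / 192 + 3 / 32 * 2 ^ (2 * k) + 7 / 24 * 2 ^ k
def iG (k : ℕ) : ℚ := 2 ^ (3 * k) / 96 + 2 ^ (2 * k) / 16 - 2 ^ k / 6
def jG (k : ℕ) : ℚ := 2 ^ (3 * k) / 64 - 3 / 32 * 2 ^ (2 * k) + 2 ^ k / 8
def lG (k : ℕ) : ℚ := 2 ^ (3 * k) / 64 + 2 ^ (2 * k) / 32 - 2 ^ k / 8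

def aH (k : ℕ) : ℚ := 2 ^ k * (1 / 1344 * 7 ^ k + 7 / 192 * 3 ^ k + 37 / 96)
def bH (k : ℕ) : ℚ := 2 ^ k * (1 / 448 * 7 ^ k - 1 / 64 * 3 ^ k + 1 / 32)
def cH (k : ℕ) : ℚ := 2 ^ k * (1 / 448 * 7 ^ k - 1 / 64 * 3 ^ k + 1 / 32)
def dH (k : ℕ) : ℚ := 2 ^ k * (1 / 224 * 7 ^ k + 3 / 32 * 3 ^ k + 3 / 16)
def eH (k : ℕ) : ℚ := 2 ^ k * (1 / 192 * 7 ^ k + 1 / 192 * 3 ^ k - 5 / 96)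
def fH (k : ℕ) : ℚ := 2 ^ k * (1 / 168 * 7 ^ k + 1 / 24 * 3 ^ k - 1 / 6)
def gH (k : ℕ) : ℚ := 2 ^ k * (1 / 192 * 7 ^ k + 17 / 192 * 3 ^ k + 19 / 96)
def hH (k : ℕ) : ℚ := 2 ^ k * (1 / 192 * 7 ^ k - 7 / 192 * 3 ^ k + 7 / 96)
def iH (k : ℕ) : ℚ := 2 ^ k * (1 / 96 * 7 ^ k + 5 / 96 * 3 ^ k - 11 / 48)
def jH (k : ℕ) : ℚ := 2 ^ k * (1 / 64 * 7 ^ k + 1 / 64 * 3 ^ k - 5 / 32)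
def lH (k : ℕ) : ℚ := 2 ^ k * (1 / 64 * 7 ^ k - 7 / 64 * 3 ^ k + 7 / 32)

/-- The eleven block sizes for `G`. Since `cG = bG` and `gG = eG` as functions, the blocks
`bG, cG` and `eG, gG` are the summands `2 M_b` and `2 M_e`. -/
def blocksG (k : ℕ) : Fin 11 → ℚ :=
  ![aG k, bG k, cG k, dG k, eG k, fG k, gG k, hG k, iG k, jG k, lG k]

/-- The eleven block sizes for `H`. Since `cH = bH` as functions, the blocks `bH, cH` are the
summand `2 M_b`. -/
def blocksH (k : ℕ) : Fin 11 → ℚ :=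
  ![aH k, bH k, cH k, dH k, eH k, fH k, gH k, hH k, iH k, jH k, lH k]

end Order1344

/-! By Maschke and Schur, the centralizer of a complex representation of a finite group is the
product of the matrix algebras `M_d`, where `d` runs over the multiplicities of the irreducible
constituents. The character of a `k`-fold tensor power of a permutation representation is the `k`-th
power of the number of fixed points. Each multiplicity is therefore a sum over conjugacy classes of
such powers, weighted by character values and inverse centralizer orders. Integrality and
non-negativity of the block sizes come for free, since multiplicities are dimensions. What remains
is to establish the two character tables.

The tables are certified rather than derived. A virtual character of norm one with non-negative
degree is irreducible (`mem_irreducibleCharacters_of_charPairing_self`), and irreducible characters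
whose degree-weighted sum is the regular character are distinct and complete
(`irreducibleCharacters_subset_range`, `injective_of_sum_eq_regular`). The rational rows are integer
polynomials in two permutation characters and exterior squares. The two rows of degree three have
values in the field of the square root of `-7`; they remain when rational rows are subtracted from
characters induced from a cyclic subgroup of order seven
(`ClassData.exists_algEquiv_of_rational_rows`).

To make class computations finite checks, `G` is identified with the affine group of the cube over
the field of two elements, and `H` with the permutations of the fourteen imaginary octonion units
that respect signs and products. An element is determined by the images of a few base points, and
every admissible tuple of images occurs: there are `8 * 7 * 6 * 4 = 14 * 12 * 8 = 1344` of them.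
Centralizer orders become counts over explicit lists (`FrameModel`), and a list of classes is
complete once the reciprocals of its centralizer orders add up to one (`exists_isConj_of_sum_inv`).
-/

namespace Order1344

open Representation Module

/-! ### Virtual characters and a norm criterion for irreducibility. -/

section CharacterTheory

/-- The characters of the finite-dimensional complex representations of `Γ`. -/
def characters (Γ : Type) [Group Γ] : Set (Γ → ℂ) :=
  {f | ∃ (V : Type) (_ : AddCommGroup V) (_ : Module ℂ V) (_ : FiniteDimensional ℂ V)
    (ρ : Representation ℂ Γ V), ρ.character = f}

/-- The characters of the irreducible complex representations of `Γ`. -/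
def irreducibleCharacters (Γ : Type) [Group Γ] : Set (Γ → ℂ) :=
  {f | ∃ (V : Type) (_ : AddCommGroup V) (_ : Module ℂ V) (_ : FiniteDimensional ℂ V)
    (ρ : Representation ℂ Γ V), ρ.IsIrreducible ∧ ρ.character = f}

/-- The virtual characters of `Γ`: the differences of characters. -/
def virtualCharacters (Γ : Type) [Group Γ] : AddSubgroup (Γ → ℂ) :=
  AddSubgroup.closure (characters Γ)

/-- The usual pairing of class functions, in its bilinear form. -/
noncomputable def charPairing {Γ : Type} [Group Γ] [Fintype Γ] (f g : Γ → ℂ) : ℂ :=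
  (Nat.card Γ : ℂ)⁻¹ * ∑ x, f x * g x⁻¹

variable {Γ : Type} [Group Γ]

lemma character_mem_characters {V : Type} [AddCommGroup V] [Module ℂ V] [FiniteDimensional ℂ V]
    (ρ : Representation ℂ Γ V) : ρ.character ∈ characters Γ :=
  ⟨V, _, _, ‹_›, ρ, rfl⟩

/-- The decomposition of the space conjugates the action into block diagonal form, and the trace of
a block diagonal map is the sum of the traces. -/
lemma character_eq_add_of_isCompl {V : Type} [AddCommGroup V] [Module ℂ V]
    [FiniteDimensional ℂ V] (ρ : Representation ℂ Γ V) (σ τ : Subrepresentation ρ)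
    (h : IsCompl σ.toSubmodule τ.toSubmodule) :
    ρ.character = σ.toRepresentation.character + τ.toRepresentation.character := by
  ext g
  have e := LinearMap.trace_conj' (LinearMap.prodMap (σ.toRepresentation g) (τ.toRepresentation g))
    (Submodule.prodEquivOfIsCompl _ _ h)
  rw [LinearMap.trace_prodMap'] at e
  simp only [Pi.add_apply, character]
  rw [← e]
  congr 1
  ext v
  obtain ⟨⟨a, b⟩, rfl⟩ := (Submodule.prodEquivOfIsCompl _ _ h).surjective v
  simp [LinearEquiv.conj_apply, Subrepresentation.toRepresentation]

variable [Fintype Γ]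

lemma charPairing_add_left (f g h : Γ → ℂ) :
    charPairing (f + g) h = charPairing f h + charPairing g h := by
  simp [charPairing, add_mul, mul_add, Finset.sum_add_distrib]

lemma charPairing_smul_left (a : ℂ) (f h : Γ → ℂ) :
    charPairing (a • f) h = a * charPairing f h := by
  simp only [charPairing, Pi.smul_apply, smul_eq_mul, mul_assoc, ← Finset.mul_sum]; ring

lemma charPairing_comm (f g : Γ → ℂ) : charPairing f g = charPairing g f := by
  rw [charPairing, charPairing, ← Equiv.sum_comp (Equiv.inv Γ)]
  simp [mul_comm]

lemma charPairing_sum_smul_left {ι : Type*} (s : Finset ι) (a : ι → ℂ) (f : ι → Γ → ℂ)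
    (h : Γ → ℂ) : charPairing (∑ i ∈ s, a i • f i) h = ∑ i ∈ s, a i * charPairing (f i) h := by
  classical
  induction s using Finset.induction_on with
  | empty => simp [charPairing]
  | insert i s hi ih =>
    rw [Finset.sum_insert hi, Finset.sum_insert hi, charPairing_add_left, charPairing_smul_left, ih]

lemma charPairing_character {V W : Type} [AddCommGroup V] [Module ℂ V] [FiniteDimensional ℂ V]
    [AddCommGroup W] [Module ℂ W] [FiniteDimensional ℂ W]
    (ρ : Representation ℂ Γ V) (σ : Representation ℂ Γ W) :
    charPairing σ.character ρ.character = finrank ℂ (IntertwiningMap ρ σ) := by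
  have : Invertible (Nat.card Γ : ℂ) := invertibleOfNonzero (by simp)
  exact card_inv_mul_sum_char_mul_char_eq_finrank ρ σ

lemma charPairing_self_of_irreducible {χ : Γ → ℂ} (h : χ ∈ irreducibleCharacters Γ) :
    charPairing χ χ = 1 := by
  obtain ⟨V, _, _, _, ρ, hρ, rfl⟩ := h
  rw [charPairing_character]
  simp

lemma nonempty_equiv_of_charPairing_ne_zero {V W : Type} [AddCommGroup V] [Module ℂ V]
    [FiniteDimensional ℂ V] [AddCommGroup W] [Module ℂ W] [FiniteDimensional ℂ W]
    (ρ : Representation ℂ Γ V) (σ : Representation ℂ Γ W) [ρ.IsIrreducible] [σ.IsIrreducible]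
    (h : charPairing ρ.character σ.character ≠ 0) : Nonempty (σ.Equiv ρ) := by
  have : Invertible (Nat.card Γ : ℂ) := invertibleOfNonzero (by simp)
  by_contra hn
  exact h ((char_orthonormal ρ σ).trans (if_neg hn))

lemma charPairing_of_irreducible_of_ne {χ ψ : Γ → ℂ} (h : χ ∈ irreducibleCharacters Γ)
    (h' : ψ ∈ irreducibleCharacters Γ) (hne : χ ≠ ψ) : charPairing χ ψ = 0 := by
  obtain ⟨V, _, _, _, ρ, hρ, rfl⟩ := h
  obtain ⟨W, _, _, _, σ, hσ, rfl⟩ := h'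
  by_contra hn
  exact hne (char_iso (nonempty_equiv_of_charPairing_ne_zero ρ σ hn).some).symm

/-- Strong induction on the dimension: by Maschke, a proper non-zero subrepresentation has an
invariant complement, and both are of smaller dimension. -/
lemma character_mem_closure_irreducibleCharacters (n : ℕ) :
    ∀ {V : Type} [AddCommGroup V] [Module ℂ V] [FiniteDimensional ℂ V]
    (ρ : Representation ℂ Γ V), finrank ℂ V = n →
    ρ.character ∈ AddSubgroup.closure (irreducibleCharacters Γ) := by
  induction n using Nat.strong_induction_on with
  | _ n ih =>
  intro V _ _ _ ρ hn
  by_cases hirr : ρ.IsIrreducible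
  · exact AddSubgroup.subset_closure ⟨V, _, _, ‹_›, ρ, hirr, rfl⟩
  -- The zero space is not irreducible but has no proper subrepresentation either; its character is
  -- the empty sum.
  rcases subsingleton_or_nontrivial V with hV | hV
  · have : ρ.character = 0 := by
      ext g
      rw [character, Subsingleton.elim (ρ g) 0, map_zero, Pi.zero_apply]
    rw [this]
    exact zero_mem _
  have hnt : Nontrivial (Subrepresentation ρ) := by
    refine ⟨⊥, ⊤, fun h => ?_⟩
    have := congrArg Subrepresentation.toSubmodule h
    exact bot_ne_top (α := Submodule ℂ V) this
  obtain ⟨σ, hσ⟩ : ∃ σ : Subrepresentation ρ, ¬ (σ = ⊥ ∨ σ = ⊤) := by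
    by_contra! h
    exact hirr ⟨h⟩
  push Not at hσ
  have : NeZero (Nat.card Γ : ℂ) := ⟨by simp⟩
  obtain ⟨τ, hτ⟩ := exists_isCompl σ
  have hc : IsCompl σ.toSubmodule τ.toSubmodule := by
    refine IsCompl.of_eq ?_ ?_
    · exact congrArg Subrepresentation.toSubmodule hτ.inf_eq_bot
    · exact congrArg Subrepresentation.toSubmodule hτ.sup_eq_top
  have hs : σ.toSubmodule ≠ ⊥ := fun h => hσ.1 (Subrepresentation.toSubmodule_injective h)
  have hs' : σ.toSubmodule ≠ ⊤ := fun h => hσ.2 (Subrepresentation.toSubmodule_injective h)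
  have h1 := Submodule.finrank_add_eq_of_isCompl hc
  have h2 := Submodule.finrank_lt hs'
  have h3 := Submodule.one_le_finrank_iff.2 hs
  rw [character_eq_add_of_isCompl ρ σ τ hc]
  exact add_mem (ih _ (by omega) _ rfl) (ih _ (by omega) _ rfl)

lemma virtualCharacters_le_closure_irreducibleCharacters :
    virtualCharacters Γ ≤ AddSubgroup.closure (irreducibleCharacters Γ) := by
  rw [virtualCharacters, AddSubgroup.closure_le]
  rintro _ ⟨V, _, _, _, ρ, rfl⟩
  exact character_mem_closure_irreducibleCharacters _ ρ rfl

lemma exists_sum_of_mem_virtualCharacters {f : Γ → ℂ} (hf : f ∈ virtualCharacters Γ) :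
    ∃ (s : Finset (Γ → ℂ)) (c : (Γ → ℂ) → ℤ), (s : Set (Γ → ℂ)) ⊆ irreducibleCharacters Γ ∧
      f = ∑ χ ∈ s, (c χ : ℂ) • χ := by
  have h := virtualCharacters_le_closure_irreducibleCharacters hf
  rw [← Submodule.span_int_eq_addSubgroupClosure, Submodule.mem_toAddSubgroup,
    Submodule.mem_span_set] at h
  obtain ⟨c, hc, rfl⟩ := h
  refine ⟨c.support, c, hc, ?_⟩
  rw [Finsupp.sum]
  refine Finset.sum_congr rfl fun χ _ => ?_
  ext x
  simp

lemma charPairing_sum_irreducible {s : Finset (Γ → ℂ)}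
    (hs : (s : Set (Γ → ℂ)) ⊆ irreducibleCharacters Γ) (c : (Γ → ℂ) → ℤ) {χ : Γ → ℂ}
    (hχ : χ ∈ s) : charPairing (∑ χ ∈ s, (c χ : ℂ) • χ) χ = c χ := by
  rw [charPairing_sum_smul_left, Finset.sum_eq_single χ]
  · rw [charPairing_self_of_irreducible (hs hχ), mul_one]
  · intro ψ hψ hne
    rw [charPairing_of_irreducible_of_ne (hs hψ) (hs hχ) hne, mul_zero]
  · exact fun h => (h hχ).elim

/-- A virtual character of norm one with positive degree is an irreducible character. -/
theorem mem_irreducibleCharacters_of_charPairing_self {f : Γ → ℂ} (hf : f ∈ virtualCharacters Γ)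
    (hnorm : charPairing f f = 1) {n : ℕ} (hn : f 1 = n) : f ∈ irreducibleCharacters Γ := by
  obtain ⟨s, c, hs, rfl⟩ := exists_sum_of_mem_virtualCharacters hf
  -- By orthonormality the norm is the sum of the squares of the integer coefficients, so exactly
  -- one coefficient is non-zero, and it is `1` or `-1`.
  have h1 : ∑ χ ∈ s, (c χ) ^ 2 = 1 := by
    have : ((∑ χ ∈ s, (c χ) ^ 2 : ℤ) : ℂ) = 1 := by
      rw [← hnorm, charPairing_sum_smul_left]
      push_cast
      refine Finset.sum_congr rfl fun χ hχ => ?_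
      rw [charPairing_comm, charPairing_sum_irreducible hs c hχ, sq]
    exact_mod_cast this
  obtain ⟨χ, hχ, hcχ⟩ : ∃ χ ∈ s, c χ ≠ 0 := by
    by_contra! h
    rw [Finset.sum_eq_zero fun χ hχ => by simp [h χ hχ]] at h1
    exact zero_ne_one h1
  classical
  have h2 := Finset.add_sum_erase s (fun χ => (c χ) ^ 2) hχ
  have h3 : 0 < (c χ) ^ 2 := by positivity
  have h4 : ∑ ψ ∈ s.erase χ, (c ψ) ^ 2 = 0 := by
    have : 0 ≤ ∑ ψ ∈ s.erase χ, (c ψ) ^ 2 := Finset.sum_nonneg fun _ _ => sq_nonneg _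
    omega
  have h5 : ∀ ψ ∈ s, ψ ≠ χ → c ψ = 0 := fun ψ hψ hne => by
    have := (Finset.sum_eq_zero_iff_of_nonneg fun _ _ => sq_nonneg _).1 h4 ψ
      (Finset.mem_erase.2 ⟨hne, hψ⟩)
    exact pow_eq_zero_iff two_ne_zero |>.1 this
  have h6 : ∑ χ ∈ s, (c χ : ℂ) • χ = (c χ : ℂ) • χ :=
    Finset.sum_eq_single χ (fun ψ hψ hne => by simp [h5 ψ hψ hne]) fun h => (h hχ).elim
  rw [h6] at hn ⊢
  have h7 : c χ = 1 ∨ c χ = -1 := by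
    have : (c χ - 1) * (c χ + 1) = 0 := by linear_combination h2 - h4 + h1
    rcases mul_eq_zero.1 this with h | h <;> omega
  rcases h7 with h7 | h7
  · rw [h7]
    simpa using hs hχ
  -- With coefficient `-1` the degree would be minus a dimension; being also a natural number, it
  -- would be zero, and the zero space is not irreducible.
  · exfalso
    obtain ⟨V, _, _, _, ρ, hρ, rfl⟩ := hs hχ
    rw [h7] at hn
    simp only [Int.reduceNeg, Int.cast_neg, Int.cast_one, neg_smul, one_smul, Pi.neg_apply,
      char_one] at hn
    have : (-(finrank ℂ V : ℤ)) = n := by exact_mod_cast hn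
    have h8 : finrank ℂ V = 0 := by omega
    have := finrank_zero_iff.1 h8
    have h9 : (⊥ : Subrepresentation ρ) = ⊤ :=
      Subrepresentation.toSubmodule_injective (Subsingleton.elim _ _)
    exact bot_ne_top h9

end CharacterTheory

/-! ### The centralizer as a product of matrix algebras over multiplicity spaces. -/

section CentralizerDecomposition

variable {Γ : Type} [Group Γ]

lemma finiteDimensional_intertwiningMap {V W : Type} [AddCommGroup V] [Module ℂ V]
    [FiniteDimensional ℂ V] [AddCommGroup W] [Module ℂ W] [FiniteDimensional ℂ W]
    (ρ : Representation ℂ Γ V) (σ : Representation ℂ Γ W) :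
    FiniteDimensional ℂ (IntertwiningMap ρ σ) :=
  FiniteDimensional.of_injective
    ({ toFun := fun u => u.toLinearMap
       map_add' := fun _ _ => rfl
       map_smul' := fun _ _ => rfl } : IntertwiningMap ρ σ →ₗ[ℂ] V →ₗ[ℂ] W)
    (IntertwiningMap.toLinearMap_injective ρ σ)

/-- The inclusion of a subrepresentation. -/
def subtypeIntertwining {V : Type} [AddCommGroup V] [Module ℂ V] {ρ : Representation ℂ Γ V}
    (τ : Subrepresentation ρ) : IntertwiningMap τ.toRepresentation ρ where
  toLinearMap := τ.toSubmodule.subtype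
  isIntertwining' _ := rfl

/-- The image of a subrepresentation of a subrepresentation. -/
def mapSubrepresentation {V : Type} [AddCommGroup V] [Module ℂ V] {ρ : Representation ℂ Γ V}
    (τ : Subrepresentation ρ) (κ : Subrepresentation τ.toRepresentation) :
    Subrepresentation ρ where
  toSubmodule := κ.toSubmodule.map τ.toSubmodule.subtype
  apply_mem_toSubmodule g := by
    rintro _ ⟨v, hv, rfl⟩
    exact ⟨τ.toRepresentation g v, κ.apply_mem_toSubmodule g hv, rfl⟩

/-- Descent on the dimension: a reducible subrepresentation contains a smaller non-zero one. -/
lemma exists_irreducible_subrepresentation {V : Type} [AddCommGroup V] [Module ℂ V]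
    [FiniteDimensional ℂ V] {ρ : Representation ℂ Γ V} (n : ℕ) :
    ∀ τ : Subrepresentation ρ, finrank ℂ τ.toSubmodule = n → τ.toSubmodule ≠ ⊥ →
      ∃ τ' : Subrepresentation ρ, τ'.toSubmodule ≤ τ.toSubmodule ∧
        τ'.toRepresentation.IsIrreducible := by
  induction n using Nat.strong_induction_on with
  | _ n ih =>
  intro τ hn hτ
  by_cases hirr : τ.toRepresentation.IsIrreducible
  · exact ⟨τ, le_rfl, hirr⟩
  have hnt : Nontrivial (Subrepresentation τ.toRepresentation) := by
    have : Nontrivial τ.toSubmodule := (Submodule.nontrivial_iff_ne_bot).2 hτ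
    exact ⟨⊥, ⊤, fun h => bot_ne_top (α := Submodule ℂ τ.toSubmodule)
      (congrArg Subrepresentation.toSubmodule h)⟩
  obtain ⟨κ, hκ⟩ : ∃ κ : Subrepresentation τ.toRepresentation, ¬ (κ = ⊥ ∨ κ = ⊤) := by
    by_contra! h
    exact hirr ⟨h⟩
  push Not at hκ
  have hs : κ.toSubmodule ≠ ⊥ := fun h => hκ.1 (Subrepresentation.toSubmodule_injective h)
  have hs' : κ.toSubmodule ≠ ⊤ := fun h => hκ.2 (Subrepresentation.toSubmodule_injective h)
  have hle : (mapSubrepresentation τ κ).toSubmodule ≤ τ.toSubmodule :=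
    Submodule.map_subtype_le _ _
  have hrank : finrank ℂ (mapSubrepresentation τ κ).toSubmodule = finrank ℂ κ.toSubmodule :=
    Submodule.finrank_map_subtype_eq _ _
  obtain ⟨τ', h1, h2⟩ := ih _ (by rw [hrank, ← hn]; exact Submodule.finrank_lt hs')
    (mapSubrepresentation τ κ) rfl (by
      intro h
      rw [← Submodule.finrank_eq_zero, hrank, Submodule.finrank_eq_zero] at h
      exact hs h)
  exact ⟨τ', h1.trans hle, h2⟩

/-- An endomorphism centralizing a representation, as an intertwining map. -/
def intertwiningOfCentralizer {V : Type} [AddCommGroup V] [Module ℂ V]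
    (ρ : Representation ℂ Γ V) (A : Subalgebra.centralizer ℂ (Set.range ρ)) :
    IntertwiningMap ρ ρ where
  toLinearMap := A.1
  isIntertwining' g := ((Subalgebra.mem_centralizer_iff ℂ).1 A.2 _ ⟨g, rfl⟩).symm

/-- The centralizer of a representation is the space of its self-intertwining maps. -/
def centralizerEquivIntertwining {V : Type} [AddCommGroup V] [Module ℂ V]
    (ρ : Representation ℂ Γ V) :
    Subalgebra.centralizer ℂ (Set.range ρ) ≃ₗ[ℂ] IntertwiningMap ρ ρ where
  toFun := intertwiningOfCentralizer ρ
  map_add' _ _ := rfl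
  map_smul' _ _ := rfl
  invFun u := ⟨u.toLinearMap, (Subalgebra.mem_centralizer_iff ℂ).2 (by
    rintro _ ⟨g, rfl⟩
    exact (u.isIntertwining' g).symm)⟩
  left_inv _ := rfl
  right_inv _ := rfl

/-- The centralizer of `ρ` acts on the multiplicity space of `σ` in `ρ` by composition. -/
def centralizerActionOnMultiplicity {V W : Type} [AddCommGroup V] [Module ℂ V]
    [AddCommGroup W] [Module ℂ W] (ρ : Representation ℂ Γ V) (σ : Representation ℂ Γ W) :
    Subalgebra.centralizer ℂ (Set.range ρ) →ₐ[ℂ] Module.End ℂ (IntertwiningMap σ ρ) where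
  toFun A :=
    { toFun := fun u => (intertwiningOfCentralizer ρ A).comp u
      map_add' := fun _ _ => IntertwiningMap.ext (LinearMap.comp_add _ _ _)
      map_smul' := fun _ _ => IntertwiningMap.ext (LinearMap.comp_smul _ _ _) }
  map_one' := rfl
  map_mul' _ _ := rfl
  map_zero' := rfl
  map_add' _ _ := rfl
  commutes' _ := rfl

lemma degree_ne_zero_of_irreducible {χ : Γ → ℂ} (hχ : χ ∈ irreducibleCharacters Γ) :
    χ 1 ≠ 0 := by
  obtain ⟨V, _, _, _, ρ, hρ, rfl⟩ := hχ
  rw [char_one]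
  intro h
  have := finrank_zero_iff.1 (show finrank ℂ V = 0 by exact_mod_cast h)
  exact bot_ne_top (α := Subrepresentation ρ)
    (Subrepresentation.toSubmodule_injective (Subsingleton.elim _ _))

variable [Fintype Γ] {ι : Type} [Fintype ι] {f : ι → Γ → ℂ}

/-- The weighted sum of the `f i` is the regular character, and pairing with the regular character
evaluates at the identity. -/
lemma sum_degree_mul_charPairing [DecidableEq Γ]
    (hreg : ∀ g, ∑ i, f i 1 * f i g = if g = 1 then (Nat.card Γ : ℂ) else 0) (χ : Γ → ℂ) :
    ∑ i, f i 1 * charPairing (f i) χ = χ 1 := by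
  rw [← charPairing_sum_smul_left]
  have : ∑ i, f i 1 • f i = fun g => if g = 1 then (Nat.card Γ : ℂ) else 0 := by
    ext g
    rw [← hreg g]
    simp
  rw [this, charPairing]
  simp

/-- Irreducible characters that add up to the regular character, with their degrees as
multiplicities, are all the irreducible characters. -/
lemma irreducibleCharacters_subset_range [DecidableEq Γ]
    (hf : ∀ i, f i ∈ irreducibleCharacters Γ)
    (hreg : ∀ g, ∑ i, f i 1 * f i g = if g = 1 then (Nat.card Γ : ℂ) else 0) :
    irreducibleCharacters Γ ⊆ Set.range f := by
  intro χ hχ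
  by_contra hn
  refine degree_ne_zero_of_irreducible hχ ?_
  rw [← sum_degree_mul_charPairing hreg χ]
  refine Finset.sum_eq_zero fun i _ => ?_
  rw [charPairing_of_irreducible_of_ne (hf i) hχ fun h => hn ⟨i, h⟩, mul_zero]

/-- Irreducible characters that add up to the regular character, with their degrees as
multiplicities, are distinct. -/
lemma injective_of_sum_eq_regular [DecidableEq Γ]
    (hf : ∀ i, f i ∈ irreducibleCharacters Γ)
    (hreg : ∀ g, ∑ i, f i 1 * f i g = if g = 1 then (Nat.card Γ : ℂ) else 0) :
    Function.Injective f := by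
  classical
  intro a b hab
  have h := sum_degree_mul_charPairing hreg (f a)
  have hterm : ∀ i, f i 1 * charPairing (f i) (f a) = if f i = f a then f a 1 else 0 := by
    intro i
    split_ifs with hi
    · rw [hi, charPairing_self_of_irreducible (hf a), mul_one]
    · rw [charPairing_of_irreducible_of_ne (hf i) (hf a) hi, mul_zero]
  rw [Finset.sum_congr rfl fun i _ => hterm i, ← Finset.sum_filter, Finset.sum_const,
    nsmul_eq_mul] at h
  have hcard : (Finset.univ.filter fun i => f i = f a).card = 1 := by
    exact_mod_cast mul_right_cancel₀ (degree_ne_zero_of_irreducible (hf a))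
      (h.trans (one_mul (f a 1)).symm)
  exact Finset.card_le_one.1 hcard.le a (by simp) b (by simp [hab])

/-- The centralizer of a representation is the product of the full matrix algebras over the
multiplicities of the irreducible characters. -/
theorem exists_centralizer_algEquiv [DecidableEq Γ]
    (hf : ∀ i, f i ∈ irreducibleCharacters Γ)
    (hreg : ∀ g, ∑ i, f i 1 * f i g = if g = 1 then (Nat.card Γ : ℂ) else 0)
    {V : Type} [AddCommGroup V] [Module ℂ V] [FiniteDimensional ℂ V]
    (ρ : Representation ℂ Γ V) :
    ∃ d : ι → ℕ, (∀ i, (d i : ℂ) = charPairing ρ.character (f i)) ∧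
      Nonempty (Subalgebra.centralizer ℂ (Set.range ρ) ≃ₐ[ℂ]
        ((i : ι) → Matrix (Fin (d i)) (Fin (d i)) ℂ)) := by
  classical
  have hsub := irreducibleCharacters_subset_range hf hreg
  have hinj := injective_of_sum_eq_regular hf hreg
  choose S i₁ i₂ i₃ σ hσ hchar using hf
  have hfin := fun i => finiteDimensional_intertwiningMap (σ i) ρ
  have hd : ∀ i, (finrank ℂ (IntertwiningMap (σ i) ρ) : ℂ) = charPairing ρ.character (f i) :=
    fun i => by rw [← hchar i, charPairing_character]
  refine ⟨fun i => finrank ℂ (IntertwiningMap (σ i) ρ), hd, ?_⟩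
  have horth : ∀ i j, charPairing (f i) (f j) = if i = j then 1 else 0 := by
    intro i j
    have hmem : ∀ i, f i ∈ irreducibleCharacters Γ := fun i =>
      ⟨S i, i₁ i, i₂ i, i₃ i, σ i, hσ i, hchar i⟩
    split_ifs with h
    · rw [h, charPairing_self_of_irreducible (hmem j)]
    · exact charPairing_of_irreducible_of_ne (hmem i) (hmem j) (hinj.ne h)
  -- Both dimensions are the sum of the squared multiplicities: on the left this is the norm of the
  -- character of `ρ`, expanded in the orthonormal family `f`.
  have hrank : finrank ℂ (Subalgebra.centralizer ℂ (Set.range ρ)) =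
      finrank ℂ ((i : ι) → Module.End ℂ (IntertwiningMap (σ i) ρ)) := by
    rw [(centralizerEquivIntertwining ρ).finrank_eq, finrank_pi_fintype]
    simp only [Module.End, finrank_linearMap]
    have hmem : ρ.character ∈ Submodule.span ℤ (Set.range f) := by
      have h := virtualCharacters_le_closure_irreducibleCharacters
        (AddSubgroup.subset_closure (character_mem_characters ρ))
      rw [← Submodule.span_int_eq_addSubgroupClosure, Submodule.mem_toAddSubgroup] at h
      exact Submodule.span_mono hsub h
    obtain ⟨c, hc⟩ := (Submodule.mem_span_range_iff_exists_fun ℤ).1 hmem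
    have hc' : ρ.character = ∑ i, (c i : ℂ) • f i := by
      rw [← hc]
      refine Finset.sum_congr rfl fun i _ => ?_
      ext x
      simp
    have hdc : ∀ i, (finrank ℂ (IntertwiningMap (σ i) ρ) : ℂ) = c i := by
      intro i
      rw [hd, hc', charPairing_sum_smul_left]
      simp [horth]
    have : (finrank ℂ (IntertwiningMap ρ ρ) : ℂ) =
        ∑ i, (finrank ℂ (IntertwiningMap (σ i) ρ) : ℂ) *
          finrank ℂ (IntertwiningMap (σ i) ρ) := by
      rw [← charPairing_character]
      nth_rw 1 [hc']
      rw [charPairing_sum_smul_left]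
      refine Finset.sum_congr rfl fun i _ => ?_
      rw [charPairing_comm, ← hd, hdc]
    exact_mod_cast this
  have := finiteDimensional_intertwiningMap ρ ρ
  have : FiniteDimensional ℂ (Subalgebra.centralizer ℂ (Set.range ρ)) :=
    (centralizerEquivIntertwining ρ).symm.finiteDimensional
  let Φ : Subalgebra.centralizer ℂ (Set.range ρ) →ₐ[ℂ]
      ((i : ι) → Module.End ℂ (IntertwiningMap (σ i) ρ)) :=
    AlgHom.pi fun i => centralizerActionOnMultiplicity ρ (σ i)
  -- If `A` kills every multiplicity space, it kills every irreducible subrepresentation. An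
  -- invariant complement of its kernel then contains no irreducible subrepresentation and must
  -- vanish.
  have hΦ : Function.Injective Φ := by
    rw [injective_iff_map_eq_zero]
    intro A hA
    have : NeZero (Nat.card Γ : ℂ) := ⟨by simp⟩
    obtain ⟨τ, hτ⟩ := exists_isCompl (intertwiningOfCentralizer ρ A).ker
    have hbot : τ.toSubmodule = ⊥ := by
      by_contra hne
      obtain ⟨τ', hle, hirr⟩ := exists_irreducible_subrepresentation _ τ rfl hne
      obtain ⟨i, hi⟩ := hsub ⟨_, _, _, inferInstance, τ'.toRepresentation, hirr, rfl⟩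
      obtain ⟨e⟩ := nonempty_equiv_of_charPairing_ne_zero τ'.toRepresentation (σ i) (by
        rw [hchar i, hi, charPairing_self_of_irreducible ⟨_, _, _, inferInstance, _, hirr, rfl⟩]
        exact one_ne_zero)
      have hu := congrArg (fun F => F i ((subtypeIntertwining τ').comp e.toIntertwiningMap)) hA
      have hker : τ' ≤ (intertwiningOfCentralizer ρ A).ker := by
        intro v hv
        have := congrArg (fun u => u (e.symm ⟨v, hv⟩)) hu
        have h' : A.1 (e (e.symm ⟨v, hv⟩)).1 = 0 := this
        rw [Representation.Equiv.apply_symm_apply] at h'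
        exact h'
      have hτ' : τ' = ⊥ := le_bot_iff.1 (hτ.inf_eq_bot ▸ le_inf hker hle)
      have hss : Subsingleton τ'.toSubmodule := by
        rw [hτ']
        exact (Submodule.subsingleton_iff_eq_bot).2 rfl
      exact bot_ne_top (α := Subrepresentation τ'.toRepresentation)
        (Subrepresentation.toSubmodule_injective (Subsingleton.elim _ _))
    have htop : (intertwiningOfCentralizer ρ A).ker = ⊤ := by
      have h := hτ.sup_eq_top
      rwa [show τ = ⊥ from Subrepresentation.toSubmodule_injective hbot, sup_bot_eq] at h
    ext v
    have hv : v ∈ (intertwiningOfCentralizer ρ A).ker := htop ▸ Submodule.mem_top (x := v)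
    exact hv
  have hΦ' : Function.Surjective Φ :=
    (LinearMap.injective_iff_surjective_of_finrank_eq_finrank (f := Φ.toLinearMap) hrank).1 hΦ
  exact ⟨(AlgEquiv.ofBijective Φ ⟨hΦ, hΦ'⟩).trans (AlgEquiv.piCongrRight fun i =>
    LinearMap.toMatrixAlgEquiv (finBasis ℂ (IntertwiningMap (σ i) ρ)))⟩

end CentralizerDecomposition

/-! ### Constructions of virtual characters: products, exterior squares, permutation characters,
induction. -/

section VirtualCharacters

variable {Γ : Type} [Group Γ]

lemma character_mem_virtualCharacters {V : Type} [AddCommGroup V] [Module ℂ V]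
    [FiniteDimensional ℂ V] (ρ : Representation ℂ Γ V) : ρ.character ∈ virtualCharacters Γ :=
  AddSubgroup.subset_closure (character_mem_characters ρ)

lemma virtualCharacters_conj {f : Γ → ℂ} (hf : f ∈ virtualCharacters Γ) (g h : Γ) :
    f (h * g * h⁻¹) = f g := by
  induction hf using AddSubgroup.closure_induction with
  | mem f hf =>
    obtain ⟨V, _, _, _, ρ, rfl⟩ := hf
    exact char_conj ρ g h
  | zero => rfl
  | add a b _ _ ha hb => simp only [Pi.add_apply, ha, hb]
  | neg a _ ha => simp only [Pi.neg_apply, ha]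

lemma apply_eq_of_isConj {f : Γ → ℂ} (hf : f ∈ virtualCharacters Γ) {a b : Γ} (h : IsConj a b) :
    f a = f b := by
  obtain ⟨y, rfl⟩ := isConj_iff.1 h
  exact (virtualCharacters_conj hf a y).symm

lemma one_mem_virtualCharacters : (1 : Γ → ℂ) ∈ virtualCharacters Γ := by
  convert character_mem_virtualCharacters (Representation.trivial ℂ Γ ℂ)
  ext g
  simp [character]

lemma mul_mem_virtualCharacters {f f' : Γ → ℂ} (hf : f ∈ virtualCharacters Γ)
    (hf' : f' ∈ virtualCharacters Γ) : f * f' ∈ virtualCharacters Γ := by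
  induction hf using AddSubgroup.closure_induction with
  | mem f hf =>
    induction hf' using AddSubgroup.closure_induction with
    | mem f' hf' =>
      obtain ⟨V, _, _, _, ρ, rfl⟩ := hf
      obtain ⟨W, _, _, _, σ, rfl⟩ := hf'
      rw [← char_tensor]
      exact character_mem_virtualCharacters _
    | zero => rw [mul_zero]; exact zero_mem _
    | add a b _ _ ha hb => rw [mul_add]; exact add_mem ha hb
    | neg a _ ha => rw [mul_neg]; exact neg_mem ha
  | zero => rw [zero_mul]; exact zero_mem _
  | add a b _ _ ha hb => rw [add_mul]; exact add_mem ha hb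
  | neg a _ ha => rw [neg_mul]; exact neg_mem ha

/-- The trace on the range of an idempotent that commutes with a representation. -/
lemma trace_mul_idempotent_mem_virtualCharacters {V : Type} [AddCommGroup V] [Module ℂ V]
    [FiniteDimensional ℂ V] (ρ : Representation ℂ Γ V) (e : Module.End ℂ V) (he : e * e = e)
    (hcomm : ∀ g, Commute (ρ g) e) :
    (fun g => LinearMap.trace ℂ V (ρ g * e)) ∈ virtualCharacters Γ := by
  let τ : Subrepresentation ρ :=
    { toSubmodule := LinearMap.range e
      apply_mem_toSubmodule := by
        rintro g _ ⟨v, rfl⟩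
        exact ⟨ρ g v, (LinearMap.congr_fun (hcomm g).eq v).symm⟩ }
  convert character_mem_virtualCharacters τ.toRepresentation
  rename_i g
  have h : τ.toRepresentation g = e.rangeRestrict ∘ₗ (ρ g ∘ₗ (LinearMap.range e).subtype) := by
    ext ⟨_, v, rfl⟩
    have h1 : e (ρ g (e v)) = ρ g (e (e v)) := (LinearMap.congr_fun (hcomm g).eq (e v)).symm
    have h2 : e (e v) = e v := LinearMap.congr_fun he v
    rw [h2] at h1
    exact h1.symm
  rw [character, h]
  -- Cyclicity of the trace moves the projection to the other side, where it composes with the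
  -- inclusion to `e`.
  exact LinearMap.trace_comp_comm' (e.rangeRestrict) (ρ g ∘ₗ (LinearMap.range e).subtype)

/-- In a product basis both sides are the sum of the products of opposite matrix entries of `f` and
`g`. -/
lemma trace_map_comp_comm {V : Type} [AddCommGroup V] [Module ℂ V] [FiniteDimensional ℂ V]
    (f g : Module.End ℂ V) :
    LinearMap.trace ℂ _ (TensorProduct.map f g ∘ₗ (TensorProduct.comm ℂ V V).toLinearMap) =
      LinearMap.trace ℂ V (f * g) := by
  classical
  let b := finBasis ℂ V
  rw [LinearMap.trace_eq_matrix_trace ℂ (b.tensorProduct b), LinearMap.trace_eq_matrix_trace ℂ b,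
    LinearMap.toMatrix_mul]
  simp only [Matrix.trace, Matrix.diag_apply, Matrix.mul_apply, LinearMap.toMatrix_apply,
    Fintype.sum_prod_type, Basis.tensorProduct_apply, LinearMap.comp_apply,
    LinearEquiv.coe_coe, TensorProduct.comm_tmul, TensorProduct.map_tmul,
    Basis.tensorProduct_repr_tmul_apply, smul_eq_mul]
  refine Finset.sum_congr rfl fun i _ => Finset.sum_congr rfl fun j _ => mul_comm _ _

/-- The exterior square of a class function. -/
noncomputable def extSquare (f : Γ → ℂ) (g : Γ) : ℂ := (f g ^ 2 - f (g ^ 2)) / 2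

/-- For a character this is the trace on the antisymmetric tensors, the range of half of the
identity minus the swap. It extends to differences because the exterior square of `a + b` is the sum
of the exterior squares plus `a * b`, and that of `-a` is `a * a` minus the exterior square of `a`.
-/
lemma extSquare_mem_virtualCharacters {f : Γ → ℂ} (hf : f ∈ virtualCharacters Γ) :
    extSquare f ∈ virtualCharacters Γ := by
  induction hf using AddSubgroup.closure_induction with
  | mem f hf =>
    obtain ⟨V, _, _, _, ρ, rfl⟩ := hf
    let c : Module.End ℂ (TensorProduct ℂ V V) := (TensorProduct.comm ℂ V V).toLinearMap
    have hc : c * c = 1 := TensorProduct.ext' fun x y => rfl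
    have hcomm : ∀ g, Commute (tprod ρ ρ g) c := fun g => TensorProduct.ext' fun x y => rfl
    convert trace_mul_idempotent_mem_virtualCharacters (tprod ρ ρ) ((2 : ℂ)⁻¹ • (1 - c)) ?_ ?_
      using 1
    · ext g
      have h1 := congrFun (char_tensor ρ ρ) g
      have h2 : LinearMap.trace ℂ _ (tprod ρ ρ g * c) = LinearMap.trace ℂ V (ρ g * ρ g) :=
        trace_map_comp_comm (ρ g) (ρ g)
      rw [character, Pi.mul_apply] at h1
      rw [mul_smul_comm, mul_sub, mul_one, map_smul, map_sub, h1, h2, extSquare, ← map_mul,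
        ← pow_two g, smul_eq_mul, character, character]
      ring
    · rw [smul_mul_smul_comm, sub_mul, mul_sub, mul_sub, hc, one_mul, one_mul, mul_one]
      rw [show (1 - c - (c - 1)) = (2 : ℂ) • (1 - c) by rw [two_smul]; abel, smul_smul]
      norm_num
    · intro g
      exact ((Commute.one_right _).sub_right (hcomm g)).smul_right _
  | zero => convert zero_mem (virtualCharacters Γ); ext; simp [extSquare]
  | add a b hma hmb ha hb =>
    convert add_mem (add_mem ha hb) (mul_mem_virtualCharacters hma hmb) using 1
    ext g
    simp only [extSquare, Pi.add_apply, Pi.mul_apply]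
    ring
  | neg a hma ha =>
    convert sub_mem (mul_mem_virtualCharacters hma hma) ha using 1
    ext g
    simp only [extSquare, Pi.neg_apply, Pi.sub_apply, Pi.mul_apply]
    ring

lemma monoidAlgebra_basis_repr_single {Y : Type} [DecidableEq Y] (a b : Y) :
    (MonoidAlgebra.basis Y ℂ).repr (MonoidAlgebra.single a 1) b = if a = b then 1 else 0 := by
  rw [← MonoidAlgebra.basis_apply, Basis.repr_self, Finsupp.single_apply]

lemma trace_ofMulAction {Y : Type} [Fintype Y] [DecidableEq Y] [MulAction Γ Y] (g : Γ) :
    LinearMap.trace ℂ _ (ofMulAction ℂ Γ Y g) =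
      (Finset.univ.filter fun y : Y => g • y = y).card := by
  rw [LinearMap.trace_eq_matrix_trace ℂ (MonoidAlgebra.basis Y ℂ)]
  simp [Matrix.trace, LinearMap.toMatrix_apply, monoidAlgebra_basis_repr_single]

instance finiteDimensional_monoidAlgebra {Y : Type} [Finite Y] :
    FiniteDimensional ℂ (MonoidAlgebra ℂ Y) :=
  Module.Finite.of_basis (MonoidAlgebra.basis Y ℂ)

/-- The permutation character of an action is a virtual character. -/
lemma card_fixed_mem_virtualCharacters {Y : Type} [Fintype Y] [DecidableEq Y]
    (φ : Γ →* Equiv.Perm Y) :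
    (fun g => ((Finset.univ.filter fun y => φ g y = y).card : ℂ)) ∈ virtualCharacters Γ := by
  convert character_mem_virtualCharacters ((ofMulAction ℂ (Equiv.Perm Y) Y).comp φ) using 1
  ext g
  exact (trace_ofMulAction (φ g)).symm

lemma average_pow_mul_self {A : Type*} [Ring A] [Algebra ℂ A] (T : A) {n : ℕ} (hn : n ≠ 0)
    (hT : T ^ n = 1) :
    ((n : ℂ)⁻¹ • ∑ m ∈ Finset.range n, T ^ m) * ((n : ℂ)⁻¹ • ∑ m ∈ Finset.range n, T ^ m) =
      (n : ℂ)⁻¹ • ∑ m ∈ Finset.range n, T ^ m := by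
  have h1 : T * ∑ m ∈ Finset.range n, T ^ m = ∑ m ∈ Finset.range n, T ^ m := by
    have h := mul_geom_sum T n
    rw [hT, sub_self, sub_mul, one_mul, sub_eq_zero] at h
    exact h
  have h2 : ∀ j : ℕ, T ^ j * ∑ m ∈ Finset.range n, T ^ m = ∑ m ∈ Finset.range n, T ^ m := by
    intro j
    induction j with
    | zero => simp
    | succ j ih => rw [pow_succ, mul_assoc, h1, ih]
  rw [smul_mul_smul_comm, Finset.sum_mul, Finset.sum_congr rfl fun j _ => h2 j,
    Finset.sum_const, Finset.card_range, ← Nat.cast_smul_eq_nsmul ℂ, smul_smul]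
  congr 1
  have : (n : ℂ) ≠ 0 := by exact_mod_cast hn
  field_simp

/-- The character induced from a linear character of a cyclic subgroup. -/
lemma cyclic_induced_mem_virtualCharacters [Fintype Γ] [DecidableEq Γ] (c : Γ) {n : ℕ}
    (hn : n ≠ 0) (hc : c ^ n = 1) (ω : ℂ) (hω : ω ^ n = 1) :
    (fun g => (n : ℂ)⁻¹ * ∑ m ∈ Finset.range n,
      ω ^ m * (Finset.univ.filter fun x : Γ => g * x = x * c ^ m).card) ∈ virtualCharacters Γ := by
  let P := ofMulAction ℂ (Equiv.Perm Γ) Γ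
  -- Right translation twisted by `ω` commutes with left translations and has order dividing `n`.
  -- The average of its powers projects onto its fixed vectors, which carry the induced
  -- representation.
  let T : Module.End ℂ (MonoidAlgebra ℂ Γ) := ω • P (Equiv.mulRight c⁻¹)
  have hpow : ∀ m, T ^ m = ω ^ m • P (Equiv.mulRight (c⁻¹ ^ m)) := fun m => by
    rw [smul_pow, ← map_pow, Equiv.pow_mulRight]
  have hcomm : ∀ g, Commute (P (MulAction.toPermHom Γ Γ g)) T := fun g => by
    refine Commute.smul_right ?_ _
    rw [commute_iff_eq, ← map_mul, ← map_mul]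
    congr 1
    ext x
    simp [mul_assoc]
  convert trace_mul_idempotent_mem_virtualCharacters (P.comp (MulAction.toPermHom Γ Γ))
    ((n : ℂ)⁻¹ • ∑ m ∈ Finset.range n, T ^ m) (average_pow_mul_self T hn ?_) ?_ using 1
  · ext g
    rw [mul_smul_comm, map_smul, Finset.mul_sum (f := fun m => T ^ m), map_sum, smul_eq_mul]
    congr 1
    refine Finset.sum_congr rfl fun m _ => ?_
    rw [hpow, mul_smul_comm, map_smul, smul_eq_mul, MonoidHom.comp_apply, ← map_mul,
      trace_ofMulAction]
    congr 3
    ext x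
    simp only [Finset.mem_filter, Finset.mem_univ, true_and, Equiv.Perm.smul_def,
      Equiv.Perm.mul_apply, Equiv.coe_mulRight, MulAction.toPermHom_apply, MulAction.toPerm_apply,
      smul_eq_mul]
    rw [← mul_assoc, inv_pow, mul_inv_eq_iff_eq_mul]
  · rw [hpow, hω, inv_pow, hc, inv_one, one_smul]
    have : (Equiv.mulRight (1 : Γ)) = 1 := by ext; simp
    rw [this, map_one]
  · intro g
    exact (Commute.sum_right _ _ _ fun m _ => (hcomm g).pow_right m).smul_right _

end VirtualCharacters

/-! ### Characters of tensor powers of permutation representations. -/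

section TensorPower

/-- In the basis of tensors of letters, a diagonal matrix entry is the product over the factors of
the indicator that the letter is fixed; the sum over all tuples factors into a power. -/
lemma tensorPowerRep_character {n : ℕ} (Γ : Subgroup (Equiv.Perm (Fin n))) (k : ℕ) (g : Γ) :
    (tensorPowerRep (ofMulAction ℂ Γ (Fin n)) k).character g =
      ((Finset.univ.filter fun x => g.1 x = x).card : ℂ) ^ k := by
  rw [character, LinearMap.trace_eq_matrix_trace ℂ
    (Basis.piTensorProduct fun _ : Fin k => MonoidAlgebra.basis (Fin n) ℂ)]
  simp only [Matrix.trace, Matrix.diag_apply, LinearMap.toMatrix_apply,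
    Basis.piTensorProduct_apply]
  have h : ∀ p : Fin k → Fin n,
      (Basis.piTensorProduct fun _ : Fin k => MonoidAlgebra.basis (Fin n) ℂ).repr
        (tensorPowerRep (ofMulAction ℂ Γ (Fin n)) k g
          (PiTensorProduct.tprod ℂ fun i => MonoidAlgebra.basis (Fin n) ℂ (p i))) p =
      ∏ i, if g.1 (p i) = p i then (1 : ℂ) else 0 := by
    intro p
    rw [tensorPowerRep]
    simp only [MonoidHom.coe_mk, OneHom.coe_mk, PiTensorProduct.map_tprod]
    rw [Basis.piTensorProduct_repr_tprod_apply]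
    refine Finset.prod_congr rfl fun i _ => ?_
    simp [monoidAlgebra_basis_repr_single, Subgroup.smul_def]
  simp only [h]
  rw [← Fintype.piFinset_univ,
    ← Finset.prod_univ_sum (fun _ => Finset.univ) fun _ x => if g.1 x = x then (1 : ℂ) else 0]
  simp

end TensorPower

/-! ### Discarding empty matrix blocks. -/

section BlockReduction

/-- Blocks of size zero may be left out of a direct sum of matrix algebras. -/
lemma nonempty_multiMatrix_algEquiv_of_embedding {m n : ℕ} (d : Fin m → ℕ) (s : Fin n → Fin m)
    (hs : Function.Injective s) (hone : ∀ j, d (s j) = 1)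
    (hzero : ∀ i, i ∉ Set.range s → d i = 0) :
    Nonempty (MultiMatrix d ≃ₐ[ℂ] MultiMatrix fun _ : Fin n => 1) := by
  let Φ : MultiMatrix d →ₐ[ℂ] MultiMatrix fun _ : Fin n => 1 :=
    AlgHom.pi fun j => (Matrix.reindexAlgEquiv ℂ ℂ (finCongr (hone j))).toAlgHom.comp
      (Pi.evalAlgHom ℂ _ (s j))
  refine ⟨AlgEquiv.ofBijective Φ ⟨?_, ?_⟩⟩
  · rw [injective_iff_map_eq_zero]
    intro A hA
    funext i
    by_cases hi : i ∈ Set.range s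
    · obtain ⟨j, rfl⟩ := hi
      exact (Matrix.reindexAlgEquiv ℂ ℂ (finCongr (hone j))).injective
        ((congrFun hA j).trans (map_zero _).symm)
    · ext x
      exact (Fin.cast (hzero i hi) x).elim0
  · intro B
    -- Constant matrices avoid transporting entries along the equalities of block sizes; by
    -- injectivity of `s` at most one summand is non-zero.
    refine ⟨fun i _ _ => ∑ j, if s j = i then B j 0 0 else 0, ?_⟩
    funext j
    ext a b
    rw [Subsingleton.elim a 0, Subsingleton.elim b 0]
    change (∑ j', if s j' = s j then B j' 0 0 else 0) = B j 0 0
    simp [hs.eq_iff]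

end BlockReduction

/-! ### Centralizer orders, the class equation and sums over classes. -/

section ConjugacyClasses

variable {Γ : Type} [Group Γ] [Fintype Γ] [DecidableEq Γ]

/-- The number of elements `x` with `x⁻¹ * a * x = b`. -/
def transporterCard (a b : Γ) : ℕ := (Finset.univ.filter fun x : Γ => a * x = x * b).card

lemma transporterCard_conj_right (a b y : Γ) :
    transporterCard a (y * b * y⁻¹) = transporterCard a b := by
  refine Finset.card_equiv (Equiv.mulRight y) fun x => ?_
  simp only [Finset.mem_filter, Finset.mem_univ, true_and, Equiv.coe_mulRight]
  rw [← mul_assoc, ← mul_assoc, ← mul_assoc, eq_mul_inv_iff_mul_eq]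

lemma transporterCard_comm (a b : Γ) : transporterCard a b = transporterCard b a := by
  refine Finset.card_equiv (Equiv.inv Γ) fun x => ?_
  simp only [Finset.mem_filter, Finset.mem_univ, true_and, Equiv.inv_apply]
  rw [eq_inv_mul_iff_mul_eq, ← mul_assoc, mul_inv_eq_iff_eq_mul, eq_comm]

lemma transporterCard_inv (a b : Γ) : transporterCard a⁻¹ b⁻¹ = transporterCard a b := by
  refine Finset.card_equiv (Equiv.refl Γ) fun x => ?_
  simp only [Finset.mem_filter, Finset.mem_univ, true_and, Equiv.refl_apply]
  rw [inv_mul_eq_iff_eq_mul, ← mul_assoc, eq_mul_inv_iff_mul_eq, eq_comm]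

/-- The elements carrying `a` to a conjugate form a coset of the centralizer of `a`. -/
lemma transporterCard_of_isConj {a b : Γ} (h : IsConj a b) :
    transporterCard a b = transporterCard a a := by
  obtain ⟨y, rfl⟩ := isConj_iff.1 h
  exact transporterCard_conj_right a a y

lemma transporterCard_self_of_isConj {a b : Γ} (h : IsConj a b) :
    transporterCard a a = transporterCard b b := by
  rw [← transporterCard_of_isConj h, transporterCard_comm, transporterCard_of_isConj h.symm]

lemma transporterCard_eq_zero {a b : Γ} (h : ¬ IsConj a b) : transporterCard a b = 0 := by
  rw [transporterCard, Finset.card_eq_zero, Finset.filter_eq_empty_iff]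
  intro x _ hx
  refine h (isConj_iff.2 ⟨x⁻¹, ?_⟩)
  rw [mul_assoc, inv_inv, hx, inv_mul_cancel_left]

lemma not_isConj_of_transporterCard_eq_zero {a b : Γ} (h : transporterCard a b = 0) :
    ¬ IsConj a b := by
  intro hc
  rw [transporterCard_of_isConj hc, transporterCard, Finset.card_eq_zero,
    Finset.filter_eq_empty_iff] at h
  exact h (Finset.mem_univ 1) (by simp)

variable {κ : Type} [Fintype κ] {r : κ → Γ} {N : κ → ℕ}

/-- Pairwise non-conjugate elements whose centralizer orders satisfy the class equation represent
all conjugacy classes. -/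
lemma exists_isConj_of_sum_inv (hN : ∀ i, transporterCard (r i) (r i) = N i)
    (hnc : ∀ i j, IsConj (r i) (r j) → i = j) (hsum : ∑ i, (N i : ℚ)⁻¹ = 1) (g : Γ) :
    ∃ i, IsConj g (r i) := by
  classical
  have hpos : ∀ i, (N i : ℚ) ≠ 0 := fun i h => by
    have h0 : transporterCard (r i) (r i) = 0 := by rw [hN]; exact_mod_cast h
    exact not_isConj_of_transporterCard_eq_zero h0 (IsConj.refl _)
  have hval : ∀ g i, (N i : ℚ)⁻¹ * transporterCard g (r i) = if IsConj g (r i) then 1 else 0 := by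
    intro g i
    split_ifs with h
    · rw [transporterCard_comm, transporterCard_of_isConj h.symm, hN, inv_mul_cancel₀ (hpos i)]
    · rw [transporterCard_eq_zero h, Nat.cast_zero, mul_zero]
  -- The sum counts the representatives conjugate to `g`, hence is at most one. Its total over `g`
  -- is the group order times the sum of the reciprocals, which is the group order, so it equals one
  -- everywhere.
  have hle : ∀ g, ∑ i, (N i : ℚ)⁻¹ * transporterCard g (r i) ≤ 1 := by
    intro g
    simp only [hval]
    rw [Finset.sum_boole]
    have : (Finset.univ.filter fun i => IsConj g (r i)).card ≤ 1 :=
      Finset.card_le_one.2 fun i hi j hj => hnc i j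
        (((Finset.mem_filter.1 hi).2).symm.trans (Finset.mem_filter.1 hj).2)
    exact_mod_cast this
  have hcount : ∀ a : Γ, ∑ g, transporterCard g a = Fintype.card Γ := by
    intro a
    simp only [transporterCard, Finset.card_filter]
    rw [Finset.sum_comm]
    simp [← eq_mul_inv_iff_mul_eq]
  have htot : ∑ g : Γ, ∑ i, (N i : ℚ)⁻¹ * transporterCard g (r i) = ∑ _g : Γ, (1 : ℚ) := by
    rw [Finset.sum_comm]
    simp only [← Finset.mul_sum, ← Nat.cast_sum, hcount]
    rw [← Finset.sum_mul, hsum]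
    simp
  have := (Finset.sum_eq_sum_iff_of_le fun g _ => hle g).1 htot g (Finset.mem_univ g)
  by_contra! hn
  rw [Finset.sum_eq_zero fun i _ => by rw [hval, if_neg (hn i)]] at this
  exact zero_ne_one this

/-- The pairing of class functions as a sum over conjugacy classes. -/
lemma charPairing_eq_sum_classes (hN : ∀ i, transporterCard (r i) (r i) = N i)
    (hnc : ∀ i j, IsConj (r i) (r j) → i = j) (hsum : ∑ i, (N i : ℚ)⁻¹ = 1)
    {f f' : Γ → ℂ} (hf : f ∈ virtualCharacters Γ) (hf' : f' ∈ virtualCharacters Γ) :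
    charPairing f f' = ∑ i, (N i : ℂ)⁻¹ * (f (r i) * f' (r i)⁻¹) := by
  classical
  have hpos : ∀ i, (N i : ℂ) ≠ 0 := fun i h => by
    have h0 : transporterCard (r i) (r i) = 0 := by rw [hN]; exact_mod_cast h
    exact not_isConj_of_transporterCard_eq_zero h0 (IsConj.refl _)
  have hval : ∀ g, ∑ i, (N i : ℂ)⁻¹ * transporterCard g (r i) = 1 := by
    intro g
    obtain ⟨i, hi⟩ := exists_isConj_of_sum_inv hN hnc hsum g
    rw [Finset.sum_eq_single i]
    · rw [transporterCard_comm, transporterCard_of_isConj hi.symm, hN, inv_mul_cancel₀ (hpos i)]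
    · intro j _ hj
      rw [transporterCard_eq_zero fun h => hj (hnc j i (h.symm.trans hi)), Nat.cast_zero, mul_zero]
    · simp
  -- Exchanging the sums, each `x` contributes the single element `x * r i * x⁻¹`, at which the
  -- class functions take their values for `r i`.
  have hsumF : ∀ i, ∑ g, (transporterCard g (r i) : ℂ) * (f g * f' g⁻¹) =
      Nat.card Γ * (f (r i) * f' (r i)⁻¹) := by
    intro i
    simp only [transporterCard, Finset.card_filter, Nat.cast_sum, Finset.sum_mul]
    rw [Finset.sum_comm]
    have : ∀ x : Γ, ∑ g : Γ, ((if g * x = x * r i then 1 else 0 : ℕ) : ℂ) * (f g * f' g⁻¹) =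
        f (r i) * f' (r i)⁻¹ := by
      intro x
      simp only [← eq_mul_inv_iff_mul_eq, Nat.cast_ite, Nat.cast_one, Nat.cast_zero, ite_mul,
        one_mul, zero_mul, Finset.sum_ite_eq', Finset.mem_univ, if_true]
      rw [virtualCharacters_conj hf, mul_inv_rev, inv_inv, mul_inv_rev, ← mul_assoc,
        virtualCharacters_conj hf']
    rw [Finset.sum_congr rfl fun x _ => this x]
    simp [Nat.card_eq_fintype_card]
  have hcard : (Nat.card Γ : ℂ) ≠ 0 := by simp
  rw [charPairing]
  have : ∑ g, f g * f' g⁻¹ =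
      ∑ g, (∑ i, (N i : ℂ)⁻¹ * transporterCard g (r i)) * (f g * f' g⁻¹) := by
    simp [hval]
  rw [this]
  simp only [Finset.sum_mul]
  rw [Finset.sum_comm, Finset.mul_sum]
  refine Finset.sum_congr rfl fun i _ => ?_
  simp only [mul_assoc]
  rw [← Finset.mul_sum, hsumF]
  field_simp

end ConjugacyClasses

/-! ### Class data and the certification of a character table. -/

section CharacterTables

/-- Representatives of the conjugacy classes of a group with eleven classes: the class `0` is
that of the identity, the classes `1` and `2` consist of mutually inverse elements of order seven
with centralizers of order seven, and all other classes are closed under inversion. -/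
structure ClassData (Γ : Type) [Group Γ] [Fintype Γ] [DecidableEq Γ] where
  rep : Fin 11 → Γ
  centralizerCard : Fin 11 → ℕ
  transporterCard_rep : ∀ i, transporterCard (rep i) (rep i) = centralizerCard i
  eq_of_isConj : ∀ i j, IsConj (rep i) (rep j) → i = j
  sum_inv : ∑ i, (centralizerCard i : ℚ)⁻¹ = 1
  rep_zero : rep 0 = 1
  rep_two : rep 2 = (rep 1)⁻¹
  rep_one_pow : rep 1 ^ 7 = 1
  isConj_sq : IsConj (rep 1 ^ 2) (rep 1)
  isConj_inv : ∀ i, IsConj (rep i)⁻¹ (rep (Equiv.swap 1 2 i))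

namespace ClassData

variable {Γ : Type} [Group Γ] [Fintype Γ] [DecidableEq Γ] (D : ClassData Γ)

lemma exists_isConj (g : Γ) : ∃ i, IsConj g (D.rep i) :=
  exists_isConj_of_sum_inv D.transporterCard_rep D.eq_of_isConj D.sum_inv g

/-- The class of the powers of the chosen element of order seven. -/
def powClass (m : ℕ) : Fin 11 := if m = 0 then 0 else if m = 1 ∨ m = 2 ∨ m = 4 then 1 else 2

/-- Squaring preserves the class, which covers the exponents 1, 2 and 4, the squares modulo seven.
The exponents 3, 5 and 6 are their negatives and give the inverse class. -/
lemma isConj_pow {m : ℕ} (hm : m < 7) : IsConj (D.rep 1 ^ m) (D.rep (powClass m)) := by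
  have h2 := D.isConj_sq
  have h4 : IsConj (D.rep 1 ^ 4) (D.rep 1) := by
    rw [show 4 = 2 * 2 from rfl, pow_mul]
    exact (h2.pow 2).trans h2
  have hinv : ∀ {a b : Γ}, IsConj a b → IsConj a⁻¹ b⁻¹ := fun {a b} h => by
    obtain ⟨y, rfl⟩ := isConj_iff.1 h
    exact isConj_iff.2 ⟨y, by group⟩
  have hneg : ∀ m n : ℕ, m + n = 7 → D.rep 1 ^ m = (D.rep 1 ^ n)⁻¹ := fun m n h => by
    rw [eq_inv_iff_mul_eq_one, ← pow_add, h, D.rep_one_pow]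
  interval_cases m
  · simp [powClass, D.rep_zero]
  · simpa [powClass] using IsConj.refl (D.rep 1)
  · exact h2
  · rw [hneg 3 4 rfl]
    change IsConj _ (D.rep 2)
    rw [D.rep_two]
    exact hinv h4
  · exact h4
  · rw [hneg 5 2 rfl]
    change IsConj _ (D.rep 2)
    rw [D.rep_two]
    exact hinv h2
  · rw [hneg 6 1 rfl, pow_one]
    change IsConj _ (D.rep 2)
    rw [D.rep_two]

/-- The character induced from the linear character of the cyclic group generated by the chosen
element of order seven that sends the generator to `ω`. -/
noncomputable def induced (ω : ℂ) (g : Γ) : ℂ :=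
  (7 : ℂ)⁻¹ * ∑ m ∈ Finset.range 7, ω ^ m * transporterCard g (D.rep 1 ^ m)

lemma induced_mem {ω : ℂ} (hω : ω ^ 7 = 1) : D.induced ω ∈ virtualCharacters Γ := by
  have h := cyclic_induced_mem_virtualCharacters (D.rep 1) (n := 7) (by norm_num) D.rep_one_pow ω hω
  exact_mod_cast h

/-- Only those exponents contribute whose power lies in the class of `D.rep j`, each with weight the
centralizer order. -/
lemma induced_rep (ω : ℂ) (j : Fin 11) :
    D.induced ω (D.rep j) = (7 : ℂ)⁻¹ * (D.centralizerCard j *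
      (if j = 0 then 1 else if j = 1 then ω + ω ^ 2 + ω ^ 4 else
        if j = 2 then ω ^ 3 + ω ^ 5 + ω ^ 6 else 0)) := by
  have h : ∀ m ∈ Finset.range 7, ω ^ m * (transporterCard (D.rep j) (D.rep 1 ^ m) : ℂ) =
      if j = powClass m then ω ^ m * D.centralizerCard j else 0 := by
    intro m hm
    have hc := D.isConj_pow (Finset.mem_range.1 hm)
    split_ifs with hj
    · rw [transporterCard_of_isConj (hj ▸ hc.symm), D.transporterCard_rep]
    · rw [transporterCard_eq_zero fun h => hj (D.eq_of_isConj _ _ (h.trans hc)), Nat.cast_zero,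
        mul_zero]
  rw [induced, Finset.sum_congr rfl h]
  congr 1
  simp only [Finset.sum_range_succ, Finset.range_zero, Finset.sum_empty, powClass]
  by_cases h0 : j = 0
  · subst h0
    simp
  by_cases h1 : j = 1
  · subst h1
    simp
    ring
  by_cases h2 : j = 2
  · subst h2
    simp
    ring
  simp [h0, h1, h2]

/-- A table of values on the conjugacy classes of virtual characters of norm one that add up to
the regular character determines all centralizer algebras. -/
theorem exists_centralizer_algEquiv {f : Fin 11 → Γ → ℂ} (hf : ∀ i, f i ∈ virtualCharacters Γ)
    {T : Fin 11 → Fin 11 → ℂ} (hT : ∀ i j, f i (D.rep j) = T i j) {n : Fin 11 → ℕ}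
    (hdeg : ∀ i, T i 0 = n i)
    (hnorm : ∀ i, ∑ j, (D.centralizerCard j : ℂ)⁻¹ * (T i j * T i (Equiv.swap 1 2 j)) = 1)
    (hreg : ∀ j, ∑ i, T i 0 * T i j = if j = 0 then (Nat.card Γ : ℂ) else 0)
    {V : Type} [AddCommGroup V] [Module ℂ V] [FiniteDimensional ℂ V]
    (ρ : Representation ℂ Γ V) :
    ∃ d : Fin 11 → ℕ, (∀ i, (d i : ℂ) = ∑ j, (D.centralizerCard j : ℂ)⁻¹ *
        (ρ.character (D.rep j) * T i (Equiv.swap 1 2 j))) ∧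
      Nonempty (Subalgebra.centralizer ℂ (Set.range ρ) ≃ₐ[ℂ] MultiMatrix d) := by
  have hpair : ∀ {χ : Γ → ℂ}, χ ∈ virtualCharacters Γ → ∀ i, charPairing χ (f i) =
      ∑ j, (D.centralizerCard j : ℂ)⁻¹ * (χ (D.rep j) * T i (Equiv.swap 1 2 j)) := by
    intro χ hχ i
    rw [charPairing_eq_sum_classes D.transporterCard_rep D.eq_of_isConj D.sum_inv hχ (hf i)]
    refine Finset.sum_congr rfl fun j _ => ?_
    rw [apply_eq_of_isConj (hf i) (D.isConj_inv j), hT]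
  have hone : ∀ i, f i 1 = T i 0 := fun i => by rw [← hT, D.rep_zero]
  have hirr : ∀ i, f i ∈ irreducibleCharacters Γ := fun i =>
    mem_irreducibleCharacters_of_charPairing_self (hf i)
      (by simpa only [hpair (hf i), hT] using hnorm i) ((hone i).trans (hdeg i))
  have hreg' : ∀ g, ∑ i, f i 1 * f i g = if g = 1 then (Nat.card Γ : ℂ) else 0 := by
    intro g
    obtain ⟨j, hj⟩ := D.exists_isConj g
    have hval : ∀ i, f i g = T i j := fun i => by rw [apply_eq_of_isConj (hf i) hj, hT]
    simp only [hone, hval, hreg]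
    refine if_congr ⟨fun h => ?_, fun h => ?_⟩ rfl rfl
    · rw [h, D.rep_zero] at hj
      exact isConj_one_left.1 hj
    · rw [h, ← D.rep_zero] at hj
      exact (D.eq_of_isConj _ _ hj).symm
  obtain ⟨d, hd, e⟩ := Order1344.exists_centralizer_algEquiv hirr hreg' ρ
  exact ⟨d, fun i => (hd i).trans (hpair (character_mem_virtualCharacters ρ) i), e⟩

end ClassData

/-- The inversion of the classes is determined by conjugation invariants that separate all classes
but `1` and `2`. -/
lemma isConj_inv_rep {Γ : Type} [Group Γ] [Fintype Γ] [DecidableEq Γ] {rep : Fin 11 → Γ}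
    {N fix : Fin 11 → ℕ} {v : Γ → ℕ} (hN : ∀ i, transporterCard (rep i) (rep i) = N i)
    (hnc : ∀ i j, IsConj (rep i) (rep j) → i = j) (hsum : ∑ i, (N i : ℚ)⁻¹ = 1)
    (hv : ∀ a b, IsConj a b → v a = v b) (hvinv : ∀ a, v a⁻¹ = v a)
    (hfix : ∀ i, v (rep i) = fix i)
    (hsep : ∀ i j, N i = N j → fix i = fix j → i = j ∨ (i = 1 ∧ j = 2) ∨ (i = 2 ∧ j = 1))
    (h2 : rep 2 = (rep 1)⁻¹) (i : Fin 11) : IsConj (rep i)⁻¹ (rep (Equiv.swap 1 2 i)) := by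
  by_cases hi1 : i = 1
  · rw [hi1, Equiv.swap_apply_left, h2]
  by_cases hi2 : i = 2
  · rw [hi2, Equiv.swap_apply_right, h2, inv_inv]
  rw [Equiv.swap_apply_of_ne_of_ne hi1 hi2]
  obtain ⟨j, hj⟩ := exists_isConj_of_sum_inv hN hnc hsum (rep i)⁻¹
  have h3 : N i = N j := by
    rw [← hN, ← hN, ← transporterCard_self_of_isConj hj, transporterCard_inv]
  have h4 : fix i = fix j := by rw [← hfix, ← hfix, ← hv _ _ hj, hvinv]
  rcases hsep i j h3 h4 with rfl | h | h
  · exact hj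
  · exact (hi1 h.1).elim
  · exact (hi2 h.1).elim

/-- The classes are distinct if the invariants separate all but `1` and `2`, and these are
distinct. -/
lemma eq_of_isConj_rep {Γ : Type} [Group Γ] [Fintype Γ] [DecidableEq Γ] {rep : Fin 11 → Γ}
    {N fix : Fin 11 → ℕ} {v : Γ → ℕ} (hN : ∀ i, transporterCard (rep i) (rep i) = N i)
    (hv : ∀ a b, IsConj a b → v a = v b) (hfix : ∀ i, v (rep i) = fix i)
    (hsep : ∀ i j, N i = N j → fix i = fix j → i = j ∨ (i = 1 ∧ j = 2) ∨ (i = 2 ∧ j = 1))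
    (h12 : transporterCard (rep 1) (rep 2) = 0) (i j : Fin 11) (h : IsConj (rep i) (rep j)) :
    i = j := by
  have hn := not_isConj_of_transporterCard_eq_zero h12
  have h3 : N i = N j := by rw [← hN, ← hN, transporterCard_self_of_isConj h]
  have h4 : fix i = fix j := by rw [← hfix, ← hfix, hv _ _ h]
  rcases hsep i j h3 h4 with hij | ⟨rfl, rfl⟩ | ⟨rfl, rfl⟩
  · exact hij
  · exact (hn h).elim
  · exact (hn h.symm).elim

/-- The two irrationalities of the character tables: the sums of the seventh roots of unity over
the squares and the non-squares modulo seven. -/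
lemma exists_seventh_root_sums : ∃ ζ : ℂ, ζ ^ 7 = 1 ∧
    (ζ + ζ ^ 2 + ζ ^ 4) + (ζ ^ 3 + ζ ^ 5 + ζ ^ 6) = -1 ∧
    (ζ + ζ ^ 2 + ζ ^ 4) * (ζ ^ 3 + ζ ^ 5 + ζ ^ 6) = 2 := by
  have hp := Complex.isPrimitiveRoot_exp 7 (by norm_num)
  set ζ := Complex.exp (2 * Real.pi * Complex.I / (7 : ℕ))
  have h7 : ζ ^ 7 = 1 := hp.pow_eq_one
  have hs := hp.geom_sum_eq_zero (by norm_num)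
  simp only [Finset.sum_range_succ, Finset.range_zero, Finset.sum_empty] at hs
  refine ⟨ζ, h7, by linear_combination hs, ?_⟩
  -- Of the nine exponents in the product, three equal seven and the others are the six non-zero
  -- residues once each, so the product is `3 - 1`; the multiple of `h7` reduces exponents modulo
  -- seven.
  linear_combination hs + (ζ ^ 3 + ζ + 3 + ζ ^ 2) * h7

end CharacterTables

/-! ### A computable model of a permutation group by images of base points. -/

section Frames

/-- A description of a permutation group by the images of some base points. -/
structure FrameModel {n : ℕ} (Γ : Subgroup (Equiv.Perm (Fin n))) (B : Type) where
  frames : List B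
  nodup : frames.Nodup
  base : List ℕ
  act : B → ℕ → ℕ
  frame : Γ → B
  frame_mem : ∀ g, frame g ∈ frames
  act_frame : ∀ (g : Γ) (x : Fin n), act (frame g) x = (g.1 x : ℕ)
  base_lt : ∀ x ∈ base, x < n
  frame_ext : ∀ g h : Γ, (∀ x : Fin n, (x : ℕ) ∈ base → g.1 x = h.1 x) → g = h
  exists_of_mem : ∀ t ∈ frames, ∃ g, frame g = t

namespace FrameModel

variable {n : ℕ} {Γ : Subgroup (Equiv.Perm (Fin n))} {B : Type} (M : FrameModel Γ B)

lemma frame_injective : Function.Injective M.frame := fun g h hgh =>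
  M.frame_ext g h fun x _ => Fin.ext (by rw [← M.act_frame, ← M.act_frame, hgh])

lemma card_filter_eq [Fintype Γ] (p : Γ → Prop) [DecidablePred p] (q : B → Bool)
    (hpq : ∀ g, p g ↔ q (M.frame g) = true) :
    (Finset.univ.filter p).card = M.frames.countP q := by
  classical
  rw [List.countP_eq_length_filter, ← List.toFinset_card_of_nodup (M.nodup.filter q)]
  refine Finset.card_bij (fun g _ => M.frame g) ?_ (fun _ _ _ _ h => M.frame_injective h) ?_
  · intro g hg
    rw [List.mem_toFinset, List.mem_filter]
    exact ⟨M.frame_mem g, (hpq g).1 (Finset.mem_filter.1 hg).2⟩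
  · intro t ht
    rw [List.mem_toFinset, List.mem_filter] at ht
    obtain ⟨g, rfl⟩ := M.exists_of_mem t ht.1
    exact ⟨g, Finset.mem_filter.2 ⟨Finset.mem_univ _, (hpq g).2 ht.2⟩, rfl⟩

lemma nat_card : Nat.card Γ = M.frames.length := by
  have := Fintype.ofFinite Γ
  have h := M.card_filter_eq (fun _ => True) (fun _ => true) (by simp)
  rw [Finset.filter_true, Finset.card_univ, ← Nat.card_eq_fintype_card] at h
  simpa using h

/-- The number of frames whose permutations carry `t` to `s` by conjugation. -/
def transporterCount (s t : B) : ℕ :=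
  M.frames.countP fun u => M.base.all fun x =>
    Nat.beq (M.act s (M.act u x)) (M.act u (M.act t x))

/-- Elements agreeing on the base points are equal, so the transporter equation is tested there
only; this turns a count over the group into one that can be evaluated. -/
lemma transporterCard_eq [Fintype Γ] [DecidableEq Γ] (g h : Γ) :
    transporterCard g h = M.transporterCount (M.frame g) (M.frame h) := by
  refine M.card_filter_eq _ _ fun u => ?_
  rw [List.all_eq_true]
  simp only [Nat.beq_eq]
  constructor
  · intro hgh x hx
    have hgx := congrArg (fun w : Γ => ((w.1 ⟨x, M.base_lt x hx⟩ : Fin n) : ℕ)) hgh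
    simp only [Subgroup.coe_mul, Equiv.Perm.mul_apply, ← M.act_frame] at hgx
    exact hgx
  · intro hall
    refine M.frame_ext _ _ fun x hx => Fin.ext ?_
    have := hall x hx
    simpa only [Subgroup.coe_mul, Equiv.Perm.mul_apply, ← M.act_frame] using this

/-- The element with a given frame. -/
noncomputable def elt (t : B) (ht : t ∈ M.frames) : Γ := (M.exists_of_mem t ht).choose

lemma frame_elt (t : B) (ht : t ∈ M.frames) : M.frame (M.elt t ht) = t :=
  (M.exists_of_mem t ht).choose_spec

lemma elt_apply (t : B) (ht : t ∈ M.frames) (x : Fin n) :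
    (((M.elt t ht).1 x : Fin n) : ℕ) = M.act t x := by
  rw [← M.act_frame, M.frame_elt]

end FrameModel

end Frames

/-! ### Integral values of virtual characters and tables with one quadratic irrationality. -/

namespace ClassData

variable {Γ : Type} [Group Γ] [Fintype Γ] [DecidableEq Γ] (D : ClassData Γ)

/-- `f` is a virtual character with the integral values `a` on the conjugacy classes. -/
def HasValues (f : Γ → ℂ) (a : Fin 11 → ℤ) : Prop :=
  f ∈ virtualCharacters Γ ∧ ∀ j, f (D.rep j) = a j

variable {D} {f g : Γ → ℂ} {a b : Fin 11 → ℤ}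

lemma HasValues.one : D.HasValues 1 1 := ⟨one_mem_virtualCharacters, fun _ => by simp⟩

lemma HasValues.add (hf : D.HasValues f a) (hg : D.HasValues g b) : D.HasValues (f + g) (a + b) :=
  ⟨add_mem hf.1 hg.1, fun j => by simp [hf.2 j, hg.2 j]⟩

lemma HasValues.sub (hf : D.HasValues f a) (hg : D.HasValues g b) : D.HasValues (f - g) (a - b) :=
  ⟨sub_mem hf.1 hg.1, fun j => by simp [hf.2 j, hg.2 j]⟩

lemma HasValues.mul (hf : D.HasValues f a) (hg : D.HasValues g b) : D.HasValues (f * g) (a * b) :=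
  ⟨mul_mem_virtualCharacters hf.1 hg.1, fun j => by simp [hf.2 j, hg.2 j]⟩

lemma HasValues.congr (hf : D.HasValues f a) (h : a = b) : D.HasValues f b := h ▸ hf

lemma HasValues.extSquare (hf : D.HasValues f a) (hsq : ∀ j, f (D.rep j ^ 2) = b j)
    {c : Fin 11 → ℤ} (h : ∀ j, a j ^ 2 - b j = 2 * c j) : D.HasValues (extSquare f) c := by
  refine ⟨extSquare_mem_virtualCharacters hf.1, fun j => ?_⟩
  have h' : ((a j : ℂ) ^ 2 - b j) = 2 * c j := by exact_mod_cast h j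
  rw [Order1344.extSquare, hsq, hf.2, h', mul_div_cancel_left₀ _ two_ne_zero]

/-- The coefficients of the irrationality in the two non-rational rows of the table. -/
def irrationalPart (i j : Fin 11) : ℤ :=
  if i = 1 ∧ j = 1 ∨ i = 2 ∧ j = 2 then -1 else if i = 1 ∧ j = 2 ∨ i = 2 ∧ j = 1 then 1 else 0

variable (D) in
/-- A table of integers, corrected by the irrationality in the rows and columns `1` and `2`, that
satisfies the orthogonality relations, determines the multiplicities in a representation whose
character is rational. -/
theorem exists_algEquiv_of_table {f : Fin 11 → Γ → ℂ} (hf : ∀ i, f i ∈ virtualCharacters Γ)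
    {A : Fin 11 → Fin 11 → ℤ} {β : ℂ} (hβ : β ^ 2 = -β - 2)
    (hT : ∀ i j, f i (D.rep j) = A i j + β * irrationalPart i j)
    {N : Fin 11 → ℕ} (hcent : D.centralizerCard = N)
    (hdeg : ∀ i, 0 ≤ A i 0)
    (hrat : ∀ i, ∑ j, (N j : ℚ)⁻¹ * (A i j * A i (Equiv.swap 1 2 j) -
      2 * (irrationalPart i j * irrationalPart i (Equiv.swap 1 2 j))) = 1)
    (hirr : ∀ i, ∑ j, (N j : ℚ)⁻¹ * (A i j * irrationalPart i (Equiv.swap 1 2 j) +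
      irrationalPart i j * A i (Equiv.swap 1 2 j) -
      irrationalPart i j * irrationalPart i (Equiv.swap 1 2 j)) = 0)
    (hreg : ∀ j, ∑ i, A i 0 * A i j = if j = 0 then (Nat.card Γ : ℤ) else 0)
    (hreg' : ∀ j, ∑ i, A i 0 * irrationalPart i j = 0)
    {V : Type} [AddCommGroup V] [Module ℂ V] [FiniteDimensional ℂ V]
    (ρ : Representation ℂ Γ V) {χ : Fin 11 → ℕ} (hχ : ∀ j, ρ.character (D.rep j) = χ j)
    (hχ' : ∀ i, ∑ j, (N j : ℚ)⁻¹ * (χ j * irrationalPart i (Equiv.swap 1 2 j)) = 0) :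
    ∃ d : Fin 11 → ℕ,
      (∀ i, (d i : ℚ) = ∑ j, (N j : ℚ)⁻¹ * (χ j * A i (Equiv.swap 1 2 j))) ∧
      Nonempty (Subalgebra.centralizer ℂ (Set.range ρ) ≃ₐ[ℂ] MultiMatrix d) := by
  subst hcent
  have hzero : ∀ i, irrationalPart i 0 = 0 := by decide
  have hdeg' : ∀ i, (A i 0 : ℂ) + β * irrationalPart i 0 = ((A i 0).toNat : ℕ) := fun i => by
    have h : ((A i 0).toNat : ℤ) = A i 0 := Int.toNat_of_nonneg (hdeg i)
    rw [hzero, Int.cast_zero, mul_zero, add_zero]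
    exact_mod_cast congrArg (fun z : ℤ => (z : ℂ)) h.symm
  -- Expanding the product and replacing `β ^ 2` by `-β - 2` gives a rational part and a multiple of
  -- `β`, whose sums are `hrat` and `hirr`.
  have hnorm : ∀ i, ∑ j, (D.centralizerCard j : ℂ)⁻¹ * ((A i j + β * irrationalPart i j) *
      (A i (Equiv.swap 1 2 j) + β * irrationalPart i (Equiv.swap 1 2 j))) = 1 := fun i => by
    have h1 := congrArg (fun q : ℚ => (q : ℂ)) (hrat i)
    have h2 := congrArg (fun q : ℚ => (q : ℂ)) (hirr i)
    push_cast at h1 h2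
    have h3 := congrArg₂ (fun x y => x + β * y) h1 h2
    simp only [Finset.mul_sum, ← Finset.sum_add_distrib, mul_zero, add_zero] at h3
    refine Eq.trans (Finset.sum_congr rfl fun j _ => ?_) h3
    linear_combination (D.centralizerCard j : ℂ)⁻¹ *
      (irrationalPart i j * irrationalPart i (Equiv.swap 1 2 j)) * hβ
  have hreg'' : ∀ j, ∑ i, ((A i 0 : ℂ) + β * irrationalPart i 0) *
      (A i j + β * irrationalPart i j) = if j = 0 then (Nat.card Γ : ℂ) else 0 := fun j => by
    have h1 := congrArg (fun z : ℤ => (z : ℂ)) (hreg j)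
    have h2 := congrArg (fun z : ℤ => (z : ℂ)) (hreg' j)
    push_cast at h1 h2
    rw [← h1, ← add_zero (∑ i, (A i 0 : ℂ) * A i j), ← mul_zero β, ← h2, Finset.mul_sum,
      ← Finset.sum_add_distrib]
    refine Finset.sum_congr rfl fun i _ => ?_
    rw [hzero]
    push_cast
    ring
  obtain ⟨d, hd, e⟩ := D.exists_centralizer_algEquiv (n := fun i => (A i 0).toNat) hf hT
    hdeg' hnorm hreg'' ρ
  refine ⟨d, fun i => ?_, e⟩
  have hχ'' := congrArg (fun q : ℚ => (q : ℂ)) (hχ' i)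
  push_cast at hχ''
  have h : (d i : ℂ) =
      ∑ j, (D.centralizerCard j : ℂ)⁻¹ * (χ j * A i (Equiv.swap 1 2 j)) := by
    rw [hd, ← add_zero (∑ j, (D.centralizerCard j : ℂ)⁻¹ * (χ j * A i (Equiv.swap 1 2 j))),
      ← mul_zero β, ← hχ'', Finset.mul_sum, ← Finset.sum_add_distrib]
    refine Finset.sum_congr rfl fun j _ => ?_
    rw [hχ]
    ring
  apply Rat.cast_injective (α := ℂ)
  push_cast
  exact h

/-- The values of the induced characters in terms of the irrationality. -/
lemma exists_induced_values (h0 : D.centralizerCard 0 = 1344) (h1 : D.centralizerCard 1 = 7)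
    (h2 : D.centralizerCard 2 = 7) :
    ∃ (β : ℂ) (I J : Γ → ℂ), β ^ 2 = -β - 2 ∧ I ∈ virtualCharacters Γ ∧
      J ∈ virtualCharacters Γ ∧
      (∀ j, I (D.rep j) = (![192, -1, 0, 0, 0, 0, 0, 0, 0, 0, 0] j : ℤ) + β * irrationalPart 1 j) ∧
      ∀ j, J (D.rep j) = (![192, 0, -1, 0, 0, 0, 0, 0, 0, 0, 0] j : ℤ) +
        β * irrationalPart 2 j := by
  obtain ⟨ζ, h7, hsum, hprod⟩ := exists_seventh_root_sums
  -- `ζ ^ 6` is the inverse of `ζ`; replacing `ζ` by it exchanges the two sums of roots of unity.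
  have h7' : (ζ ^ 6) ^ 7 = 1 := by rw [pow_right_comm, h7, one_pow]
  have hα : ζ + ζ ^ 2 + ζ ^ 4 = -1 - (ζ ^ 3 + ζ ^ 5 + ζ ^ 6) := by linear_combination hsum
  have hα' : ζ ^ 6 + (ζ ^ 6) ^ 2 + (ζ ^ 6) ^ 4 = ζ ^ 3 + ζ ^ 5 + ζ ^ 6 := by
    linear_combination (ζ ^ 5 + ζ ^ 17 + ζ ^ 10 + ζ ^ 3) * h7
  have hβ' : (ζ ^ 6) ^ 3 + (ζ ^ 6) ^ 5 + (ζ ^ 6) ^ 6 = -1 - (ζ ^ 3 + ζ ^ 5 + ζ ^ 6) := by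
    rw [← hα]
    linear_combination (ζ ^ 11 + ζ ^ 4 + ζ ^ 23 + ζ ^ 16 + ζ ^ 9 + ζ ^ 2 + ζ ^ 29 + ζ ^ 22 +
      ζ ^ 15 + ζ ^ 8 + ζ) * h7
  -- Here `β` is the sum over the non-squares modulo seven and `-1 - β` the sum over the squares;
  -- their product being 2 is the quadratic equation. The degree 192 is `1344 / 7`.
  refine ⟨ζ ^ 3 + ζ ^ 5 + ζ ^ 6, D.induced ζ, D.induced (ζ ^ 6), ?_, D.induced_mem h7,
    D.induced_mem h7', fun j => ?_, fun j => ?_⟩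
  · rw [hα] at hprod
    linear_combination -hprod
  · rw [D.induced_rep, hα]
    by_cases hj : 2 < j
    · obtain ⟨h3, h4, h5, h6, h7⟩ : j ≠ 0 ∧ j ≠ 1 ∧ j ≠ 2 ∧
          (![192, -1, 0, 0, 0, 0, 0, 0, 0, 0, 0] : Fin 11 → ℤ) j = 0 ∧ irrationalPart 1 j = 0 := by
        revert j
        decide
      simp [h3, h4, h5, h6, h7]
    · obtain rfl | rfl | rfl : j = 0 ∨ j = 1 ∨ j = 2 := by
        revert j
        decide
      · simp [show irrationalPart 1 0 = 0 by decide, h0]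
        norm_num
      · simp [show irrationalPart 1 1 = -1 by decide, h1]
        ring
      · simp [show irrationalPart 1 2 = 1 by decide, h2]
  · rw [D.induced_rep, hα', hβ']
    by_cases hj : 2 < j
    · obtain ⟨h3, h4, h5, h6, h7⟩ : j ≠ 0 ∧ j ≠ 1 ∧ j ≠ 2 ∧
          (![192, 0, -1, 0, 0, 0, 0, 0, 0, 0, 0] : Fin 11 → ℤ) j = 0 ∧ irrationalPart 2 j = 0 := by
        revert j
        decide
      simp [h3, h4, h5, h6, h7]
    · obtain rfl | rfl | rfl : j = 0 ∨ j = 1 ∨ j = 2 := by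
        revert j
        decide
      · simp [show irrationalPart 2 0 = 0 by decide, h0]
        norm_num
      · simp [show irrationalPart 2 1 = 1 by decide, h1]
      · simp [show irrationalPart 2 2 = -1 by decide, h2]
        ring

end ClassData

/-! ### Recovering the two irrational rows from the rational ones. -/

namespace ClassData

variable {Γ : Type} [Group Γ] [Fintype Γ] [DecidableEq Γ] (D : ClassData Γ)

/-- The combination of the rational rows that completes the two irrational rows to the
characters induced from the subgroup of order seven. -/
def rationalPart (A : Fin 11 → Fin 11 → ℤ) : Fin 11 → ℤ :=
  A 3 + A 4 + A 5 + A 6 + A 7 + (A 8 + A 8) + (A 9 + A 9 + A 9) + (A 10 + A 10 + A 10)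

/-- A character table whose rational rows are known to be virtual characters determines the
centralizer algebras of the representations with rational characters. -/
theorem exists_algEquiv_of_rational_rows {A : Fin 11 → Fin 11 → ℤ} {N : Fin 11 → ℕ}
    (hcent : D.centralizerCard = N) (h0 : N 0 = 1344) (h1 : N 1 = 7) (h2 : N 2 = 7)
    (hcard : Nat.card Γ = 1344)
    (hrow : ∀ i, i ≠ 1 → i ≠ 2 → ∃ f, D.HasValues f (A i))
    (hA1 : A 1 = ![192, -1, 0, 0, 0, 0, 0, 0, 0, 0, 0] - rationalPart A)
    (hA2 : A 2 = ![192, 0, -1, 0, 0, 0, 0, 0, 0, 0, 0] - rationalPart A)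
    (hdeg : ∀ i, 0 ≤ A i 0)
    (hrat : ∀ i, ∑ j, (N j : ℚ)⁻¹ * (A i j * A i (Equiv.swap 1 2 j) -
      2 * (irrationalPart i j * irrationalPart i (Equiv.swap 1 2 j))) = 1)
    (hirr : ∀ i, ∑ j, (N j : ℚ)⁻¹ * (A i j * irrationalPart i (Equiv.swap 1 2 j) +
      irrationalPart i j * A i (Equiv.swap 1 2 j) -
      irrationalPart i j * irrationalPart i (Equiv.swap 1 2 j)) = 0)
    (hreg : ∀ j, ∑ i, A i 0 * A i j = if j = 0 then 1344 else 0)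
    (hreg' : ∀ j, ∑ i, A i 0 * irrationalPart i j = 0)
    {V : Type} [AddCommGroup V] [Module ℂ V] [FiniteDimensional ℂ V]
    (ρ : Representation ℂ Γ V) {χ : Fin 11 → ℕ} (hχ : ∀ j, ρ.character (D.rep j) = χ j)
    (hχ' : χ 1 = χ 2) :
    ∃ d : Fin 11 → ℕ,
      (∀ i, (d i : ℚ) = ∑ j, (N j : ℚ)⁻¹ * (χ j * A i (Equiv.swap 1 2 j))) ∧
      Nonempty (Subalgebra.centralizer ℂ (Set.range ρ) ≃ₐ[ℂ] MultiMatrix d) := by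
  obtain ⟨β, I, J, hβ, hI, hJ, hIrep, hJrep⟩ := D.exists_induced_values
    (by rw [hcent, h0]) (by rw [hcent, h1]) (by rw [hcent, h2])
  -- For the tables used here, the coefficients 1, 1, 1, 1, 1, 2, 3, 3 are, by Frobenius
  -- reciprocity, the multiplicities of a non-trivial character of the subgroup of order seven in
  -- the rational rows. Subtracting `S` from an induced character leaves a row of degree three.
  obtain ⟨S, hS⟩ : ∃ S, D.HasValues S (rationalPart A) := by
    obtain ⟨f3, h3⟩ := hrow 3 (by decide) (by decide)
    obtain ⟨f4, h4⟩ := hrow 4 (by decide) (by decide)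
    obtain ⟨f5, h5⟩ := hrow 5 (by decide) (by decide)
    obtain ⟨f6, h6⟩ := hrow 6 (by decide) (by decide)
    obtain ⟨f7, h7⟩ := hrow 7 (by decide) (by decide)
    obtain ⟨f8, h8⟩ := hrow 8 (by decide) (by decide)
    obtain ⟨f9, h9⟩ := hrow 9 (by decide) (by decide)
    obtain ⟨f10, h10⟩ := hrow 10 (by decide) (by decide)
    exact ⟨_, (((((((h3.add h4).add h5).add h6).add h7).add (h8.add h8)).add
      ((h9.add h9).add h9)).add ((h10.add h10).add h10))⟩
  have hf : ∀ i, ∃ f ∈ virtualCharacters Γ, ∀ j,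
      f (D.rep j) = A i j + β * irrationalPart i j := by
    intro i
    by_cases hi1 : i = 1
    · subst hi1
      refine ⟨I - S, sub_mem hI hS.1, fun j => ?_⟩
      rw [Pi.sub_apply, hIrep, hS.2, hA1, Pi.sub_apply]
      push_cast
      ring
    by_cases hi2 : i = 2
    · subst hi2
      refine ⟨J - S, sub_mem hJ hS.1, fun j => ?_⟩
      rw [Pi.sub_apply, hJrep, hS.2, hA2, Pi.sub_apply]
      push_cast
      ring
    obtain ⟨f, hf⟩ := hrow i hi1 hi2
    refine ⟨f, hf.1, fun j => ?_⟩
    simp [hf.2, irrationalPart, hi1, hi2]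
  choose f hf hT using hf
  refine D.exists_algEquiv_of_table hf hβ hT hcent hdeg hrat hirr
    (by rw [hcard]; exact hreg) hreg' ρ hχ fun i => ?_
  -- The irrational part lives on the classes 1 and 2 with opposite signs, while `χ` and the
  -- centralizer orders agree there, so it cancels from every multiplicity.
  have hz : ∀ i j, j ≠ 1 ∧ j ≠ 2 → irrationalPart i (Equiv.swap 1 2 j) = 0 := by decide
  have hs : ∀ i, irrationalPart i 2 + irrationalPart i 1 = 0 := by decide
  have hs' : (irrationalPart i 2 : ℚ) + irrationalPart i 1 = 0 := by exact_mod_cast hs i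
  rw [Fintype.sum_eq_add (1 : Fin 11) 2 (by decide) fun j hj => by simp [hz i j hj],
    Equiv.swap_apply_left, Equiv.swap_apply_right, h1, h2, hχ', ← mul_add, ← mul_add, hs',
    mul_zero, mul_zero]

end ClassData

/-! ### Class data from a list of frames. -/

namespace FrameModel

variable {n : ℕ} {Γ : Subgroup (Equiv.Perm (Fin n))} {B : Type} (M : FrameModel Γ B)

lemma ext_act {g h : Γ} (hgh : ∀ x : Fin n, ((g.1 x : Fin n) : ℕ) = h.1 x) : g = h :=
  Subtype.ext (Equiv.ext fun x => Fin.ext (hgh x))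

lemma elt_pow_apply (t : B) (ht : t ∈ M.frames) (m : ℕ) (x : Fin n) :
    ((((M.elt t ht) ^ m).1 x : Fin n) : ℕ) = (M.act t)^[m] x := by
  induction m generalizing x with
  | zero => simp
  | succ m ih =>
    rw [pow_succ, Function.iterate_succ_apply, ← M.elt_apply t ht, ← ih]
    rfl

lemma elt_pow_apply_eq_ofNat [NeZero n] (t : B) (ht : t ∈ M.frames) (m : ℕ) (x : Fin n) :
    ((M.elt t ht) ^ m).1 x = Fin.ofNat n ((M.act t)^[m] x) := by
  rw [← M.elt_pow_apply t ht]
  exact (Fin.ofNat_val_eq_self _).symm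

/-- The number of points fixed by a power of the permutation with a given frame. -/
lemma card_fixed_elt_pow (t : B) (ht : t ∈ M.frames) (m : ℕ) :
    (Finset.univ.filter fun x : Fin n => ((M.elt t ht) ^ m).1 x = x).card =
      (Finset.univ.filter fun x : Fin n => (M.act t)^[m] x = x).card := by
  congr 1
  refine Finset.filter_congr fun x _ => ?_
  rw [Fin.ext_iff, M.elt_pow_apply]

lemma card_fixed_elt (t : B) (ht : t ∈ M.frames) :
    (Finset.univ.filter fun x : Fin n => (M.elt t ht).1 x = x).card =
      (Finset.univ.filter fun x : Fin n => M.act t x = x).card := by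
  simpa using M.card_fixed_elt_pow t ht 1

lemma card_fixed_eq_of_isConj {a b : Γ}
    (h : IsConj a b) : (Finset.univ.filter fun x : Fin n => a.1 x = x).card =
      (Finset.univ.filter fun x : Fin n => b.1 x = x).card := by
  obtain ⟨y, rfl⟩ := isConj_iff.1 h
  refine Finset.card_equiv y.1 fun x => ?_
  rw [Finset.mem_filter, Finset.mem_filter]
  simp

lemma card_fixed_inv (a : Γ) :
    (Finset.univ.filter fun x : Fin n => (a⁻¹).1 x = x).card =
      (Finset.univ.filter fun x : Fin n => a.1 x = x).card := by
  congr 1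
  refine Finset.filter_congr fun x _ => ?_
  rw [Subgroup.coe_inv, Equiv.Perm.inv_eq_iff_eq, eq_comm]

/-- The class data given by a list of frames. -/
noncomputable def classData [Fintype Γ] [DecidableEq Γ] {t : Fin 11 → B}
    (ht : ∀ i, t i ∈ M.frames) {N fix : Fin 11 → ℕ} {y : B} (hy : y ∈ M.frames)
    (hN : ∀ i, M.transporterCount (t i) (t i) = N i)
    (h12 : M.transporterCount (t 1) (t 2) = 0)
    (hfix : ∀ i, (Finset.univ.filter fun x : Fin n => M.act (t i) x = x).card = fix i)
    (hsep : ∀ i j, N i = N j → fix i = fix j → i = j ∨ (i = 1 ∧ j = 2) ∨ (i = 2 ∧ j = 1))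
    (hsum : ∑ i, (N i : ℚ)⁻¹ = 1)
    (h0 : ∀ x : Fin n, M.act (t 0) x = x)
    (h2 : ∀ x : Fin n, M.act (t 2) (M.act (t 1) x) = x)
    (h7 : ∀ x : Fin n, (M.act (t 1))^[7] x = x)
    (hsq : ∀ x : Fin n, M.act y ((M.act (t 1))^[2] x) = M.act (t 1) (M.act y x)) :
    ClassData Γ :=
  have hN' : ∀ i, transporterCard (M.elt (t i) (ht i)) (M.elt (t i) (ht i)) = N i := fun i => by
    rw [M.transporterCard_eq, M.frame_elt, hN]
  have hfix' : ∀ i, (Finset.univ.filter fun x : Fin n => (M.elt (t i) (ht i)).1 x = x).card =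
      fix i := fun i => by rw [M.card_fixed_elt, hfix]
  have hnc := eq_of_isConj_rep hN' (fun _ _ => card_fixed_eq_of_isConj) hfix' hsep
    (by rw [M.transporterCard_eq, M.frame_elt, M.frame_elt, h12])
  have hinv : M.elt (t 2) (ht 2) = (M.elt (t 1) (ht 1))⁻¹ := by
    rw [eq_inv_iff_mul_eq_one]
    refine ext_act fun x => ?_
    rw [Subgroup.coe_mul, Equiv.Perm.mul_apply, M.elt_apply, M.elt_apply, h2]
    rfl
  { rep := fun i => M.elt (t i) (ht i)
    centralizerCard := N
    transporterCard_rep := hN'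
    eq_of_isConj := hnc
    sum_inv := hsum
    rep_zero := ext_act fun x => by
      rw [M.elt_apply, h0]
      rfl
    rep_two := hinv
    rep_one_pow := ext_act fun x => by
      rw [M.elt_pow_apply, h7]
      rfl
    isConj_sq := isConj_iff.2 ⟨M.elt y hy, by
      rw [mul_inv_eq_iff_eq_mul]
      refine ext_act fun x => ?_
      rw [Subgroup.coe_mul, Subgroup.coe_mul, Equiv.Perm.mul_apply, Equiv.Perm.mul_apply,
        M.elt_apply, M.elt_pow_apply, M.elt_apply, M.elt_apply, hsq]⟩
    isConj_inv := isConj_inv_rep hN' hnc hsum (fun _ _ => card_fixed_eq_of_isConj)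
      card_fixed_inv hfix' hsep hinv }

end FrameModel

/-- The product of the permutations of a list at the given positions. -/
def word {α : Type*} (gens : List (Equiv.Perm α)) (w : List ℕ) : Equiv.Perm α :=
  (w.map fun i => gens.getD i 1).prod

lemma word_mem {α : Type*} {gens : List (Equiv.Perm α)} {Γ : Subgroup (Equiv.Perm α)}
    (h : ∀ g ∈ gens, g ∈ Γ) (w : List ℕ) : word gens w ∈ Γ := by
  refine Subgroup.list_prod_mem _ fun g hg => ?_
  obtain ⟨i, -, rfl⟩ := List.mem_map.1 hg
  rw [List.getD_eq_getElem?_getD]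
  rcases hi : gens[i]? with _ | g
  · exact one_mem _
  · exact h g (List.mem_of_getElem? hi)

/-! ### `G` as the affine group of the cube over the field of two elements. -/

section AffineGroup

/-- With letters read as binary vectors, `^^^` is addition, and preserving sums of three points is
affinity over the field of two elements. It is checked on the generators and survives products and
inverses. -/
lemma G_affine {g : Equiv.Perm (Fin 8)} (hg : g ∈ G) (x y z : Fin 8) :
    g (x ^^^ y ^^^ z) = g x ^^^ g y ^^^ g z := by
  induction hg using Subgroup.closure_induction generalizing x y z with
  | mem g hg =>
    simp only [Set.mem_insert_iff, Set.mem_singleton_iff] at hg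
    rcases hg with rfl | rfl | rfl | rfl <;> revert x y z <;> decide +kernel
  | one => rfl
  | mul a b _ _ ha hb => simp only [Equiv.Perm.mul_apply, hb, ha]
  | inv a _ ha =>
    apply a.injective
    simp only [ha, Equiv.Perm.inv_def, Equiv.apply_symm_apply]

/-- The value at `x` of the affine map of the cube that sends `0, 1, 2, 4` to the entries of
`t`. -/
def affineAct (t : ℕ × ℕ × ℕ × ℕ) (x : ℕ) : ℕ :=
  t.1.xor (((x % 2) * (t.2.1.xor t.1)).xor
    (((x / 2 % 2) * (t.2.2.1.xor t.1)).xor ((x / 4) * (t.2.2.2.xor t.1))))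

/-- The entries of `t` are affinely independent. -/
def affineGood (t : ℕ × ℕ × ℕ × ℕ) : Bool :=
  !Nat.beq t.1 t.2.1 && (!Nat.beq t.1 t.2.2.1 && (!Nat.beq t.2.1 t.2.2.1 &&
    (!Nat.beq t.1 t.2.2.2 && (!Nat.beq t.2.1 t.2.2.2 && (!Nat.beq t.2.2.1 t.2.2.2 &&
    !Nat.beq ((t.1.xor t.2.1).xor t.2.2.1) t.2.2.2)))))

/-- The points of the cube. -/
def cubePoints : List ℕ := [0, 1, 2, 3, 4, 5, 6, 7]

/-- The affinely independent quadruples of points of the cube. -/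
def affineFrames : List (ℕ × ℕ × ℕ × ℕ) :=
  (cubePoints ×ˢ cubePoints ×ˢ cubePoints ×ˢ cubePoints).filter affineGood

/-- The images of `0, 1, 2, 4`. -/
def affineFrame (g : G) : ℕ × ℕ × ℕ × ℕ := (g.1 0, g.1 1, g.1 2, g.1 4)

/-- The remaining points 3, 5, 6, 7 are sums of three of 0, 1, 2, 4, so affinity determines their
images. -/
lemma affineAct_frame (g : G) (x : Fin 8) : affineAct (affineFrame g) x = (g.1 x : ℕ) := by
  have h3 := G_affine g.2 0 1 2
  have h5 := G_affine g.2 0 1 4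
  have h6 := G_affine g.2 0 2 4
  have h7 := G_affine g.2 1 2 4
  have key : ∀ a b c s : Fin 8, ∀ x : Fin 8, affineAct (a, b, c, s) x =
      (![a, b, c, a ^^^ b ^^^ c, s, a ^^^ b ^^^ s, a ^^^ c ^^^ s, b ^^^ c ^^^ s] x : Fin 8) := by
    decide +kernel
  rw [affineFrame, key, ← h3, ← h5, ← h6, ← h7]
  fin_cases x <;> rfl

lemma affineFrame_mem (g : G) : affineFrame g ∈ affineFrames := by
  have hmem : ∀ x : Fin 8, (x : ℕ) ∈ cubePoints := by decide
  have key : ∀ a b c s : Fin 8, (a ≠ b ∧ a ≠ c ∧ b ≠ c ∧ a ≠ s ∧ b ≠ s ∧ c ≠ s ∧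
      a ^^^ b ^^^ c ≠ s) → affineGood (a, b, c, s) = true := by decide +kernel
  have hne : ∀ x y : Fin 8, x ≠ y → g.1 x ≠ g.1 y := fun x y h => g.1.injective.ne h
  refine List.mem_filter.2 ⟨?_, key _ _ _ _ ⟨hne _ _ (by decide), hne _ _ (by decide),
    hne _ _ (by decide), hne _ _ (by decide), hne _ _ (by decide), hne _ _ (by decide), ?_⟩⟩
  · exact List.mem_product.2 ⟨hmem _, List.mem_product.2 ⟨hmem _, List.mem_product.2
      ⟨hmem _, hmem _⟩⟩⟩
  · rw [← G_affine g.2]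
    exact hne _ _ (by decide)

/-- The generators of `G`. -/
def gensG : List (Equiv.Perm (Fin 8)) :=
  [[4, 6].formPerm * [5, 7].formPerm,
   [1, 2, 4].formPerm * [3, 6, 5].formPerm,
   [0, 1].formPerm * [2, 3].formPerm * [4, 5].formPerm * [6, 7].formPerm,
   [0, 4].formPerm * [1, 5].formPerm * [2, 6].formPerm * [3, 7].formPerm]

lemma word_gensG_mem (w : List ℕ) : word gensG w ∈ G := by
  refine word_mem (fun g hg => Subgroup.subset_closure ?_) w
  simpa [gensG] using hg

/-- First link of a stabilizer chain through 0, 1, 2, 4. Here and in the next three lemmas the list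
holds one word in the generators for each admissible point. -/
lemma G_exists_zero (x : Fin 8) : ∃ g ∈ G, g x = 0 := by
  have h : ∀ x : Fin 8, ∃ w ∈ [[], [2], [3, 1], [3, 0, 1], [3], [3, 2], [3, 0], [3, 2, 0]],
      word gensG w x = 0 := by decide +kernel
  obtain ⟨w, -, hw⟩ := h x
  exact ⟨_, word_gensG_mem w, hw⟩

lemma G_exists_one (x : Fin 8) (hx : x ≠ 0) : ∃ g ∈ G, g 0 = 0 ∧ g x = 1 := by
  have h : ∀ x : Fin 8, x ≠ 0 → ∃ w ∈ [[], [1, 1], [1, 0, 1], [1], [1, 0, 1, 1], [1, 0],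
      [1, 0, 1, 1, 0]], word gensG w 0 = 0 ∧ word gensG w x = 1 := by decide +kernel
  obtain ⟨w, -, hw⟩ := h x hx
  exact ⟨_, word_gensG_mem w, hw⟩

lemma G_exists_two (x : Fin 8) (h0 : x ≠ 0) (h1 : x ≠ 1) :
    ∃ g ∈ G, g 0 = 0 ∧ g 1 = 1 ∧ g x = 2 := by
  have h : ∀ x : Fin 8, x ≠ 0 → x ≠ 1 → ∃ w ∈ [[], [1, 1, 0, 1],
      [1, 0, 1, 0, 1, 1, 0, 1, 0, 1, 0], [1, 0, 1, 0, 1, 1, 0, 1, 1, 0],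
      [1, 0, 1, 0, 1, 1, 0, 1, 0, 1], [1, 0, 1, 0, 1, 1, 0, 1, 1]],
      word gensG w 0 = 0 ∧ word gensG w 1 = 1 ∧ word gensG w x = 2 := by decide +kernel
  obtain ⟨w, -, hw⟩ := h x h0 h1
  exact ⟨_, word_gensG_mem w, hw⟩

lemma G_exists_four (x : Fin 8) (h0 : x ≠ 0) (h1 : x ≠ 1) (h2 : x ≠ 2) (h3 : x ≠ 3) :
    ∃ g ∈ G, g 0 = 0 ∧ g 1 = 1 ∧ g 2 = 2 ∧ g x = 4 := by
  have h : ∀ x : Fin 8, x ≠ 0 → x ≠ 1 → x ≠ 2 → x ≠ 3 → ∃ w ∈ [[],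
      [1, 1, 0, 1, 0, 1, 1, 0, 1, 0], [0], [1, 1, 0, 1, 0, 1, 1, 0, 1]],
      word gensG w 0 = 0 ∧ word gensG w 1 = 1 ∧ word gensG w 2 = 2 ∧ word gensG w x = 4 := by
    decide +kernel
  obtain ⟨w, -, hw⟩ := h x h0 h1 h2 h3
  exact ⟨_, word_gensG_mem w, hw⟩

/-- `G` is transitive on the affinely independent quadruples. -/
lemma exists_affineFrame_eq (t : ℕ × ℕ × ℕ × ℕ) (ht : t ∈ affineFrames) :
    ∃ g, affineFrame g = t := by
  have key : ∀ a b c s : Fin 8, affineGood (a, b, c, s) = true →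
      a ≠ b ∧ a ≠ c ∧ b ≠ c ∧ a ≠ s ∧ b ≠ s ∧ c ≠ s ∧ s ≠ a ^^^ b ^^^ c := by decide +kernel
  have hlt : ∀ x ∈ cubePoints, x < 8 := by decide
  obtain ⟨a, b, c, s⟩ := t
  obtain ⟨hm, hgood⟩ := List.mem_filter.1 ht
  obtain ⟨ha, hm⟩ := List.mem_product.1 hm
  obtain ⟨hb, hm⟩ := List.mem_product.1 hm
  obtain ⟨hc, hs⟩ := List.mem_product.1 hm
  lift a to Fin 8 using hlt a ha
  lift b to Fin 8 using hlt b hb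
  lift c to Fin 8 using hlt c hc
  lift s to Fin 8 using hlt s hs
  obtain ⟨hab, hac, hbc, has, hbs, hcs, hsum⟩ := key a b c s hgood
  obtain ⟨g₁, m₁, e₁⟩ := G_exists_zero a
  obtain ⟨g₂, m₂, e₂, e₂'⟩ := G_exists_one (g₁ b) (e₁ ▸ g₁.injective.ne hab.symm)
  have m₂₁ := mul_mem m₂ m₁
  set h₂ := g₂ * g₁
  have ea : h₂ a = 0 := by rw [Equiv.Perm.mul_apply, e₁, e₂]
  have eb : h₂ b = 1 := e₂'
  obtain ⟨g₃, m₃, e₃, e₃', e₃''⟩ := G_exists_two (h₂ c) (ea ▸ h₂.injective.ne hac.symm)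
    (eb ▸ h₂.injective.ne hbc.symm)
  have m₃₂ := mul_mem m₃ m₂₁
  set h₃ := g₃ * h₂
  replace ea : h₃ a = 0 := by rw [Equiv.Perm.mul_apply, ea, e₃]
  replace eb : h₃ b = 1 := by rw [Equiv.Perm.mul_apply, eb, e₃']
  have ec : h₃ c = 2 := e₃''
  -- Since 3 is the sum of 0, 1 and 2, affinity would force `s` to be the sum of `a`, `b` and `c`.
  have es : h₃ s ≠ 3 := by
    have h := G_affine m₃₂ a b c
    rw [ea, eb, ec] at h
    exact fun h' => hsum (h₃.injective (h'.trans h.symm))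
  obtain ⟨g₄, m₄, e₄, e₄', e₄'', e₄'''⟩ := G_exists_four (h₃ s) (ea ▸ h₃.injective.ne has.symm)
    (eb ▸ h₃.injective.ne hbs.symm) (ec ▸ h₃.injective.ne hcs.symm) es
  refine ⟨⟨(g₄ * h₃)⁻¹, inv_mem (mul_mem m₄ m₃₂)⟩, ?_⟩
  have h0 : (g₄ * h₃)⁻¹ 0 = a := by rw [Equiv.Perm.inv_eq_iff_eq, Equiv.Perm.mul_apply, ea, e₄]
  have h1 : (g₄ * h₃)⁻¹ 1 = b := by rw [Equiv.Perm.inv_eq_iff_eq, Equiv.Perm.mul_apply, eb, e₄']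
  have h2 : (g₄ * h₃)⁻¹ 2 = c := by rw [Equiv.Perm.inv_eq_iff_eq, Equiv.Perm.mul_apply, ec, e₄'']
  have h4 : (g₄ * h₃)⁻¹ 4 = s := by rw [Equiv.Perm.inv_eq_iff_eq, Equiv.Perm.mul_apply, e₄''']
  simp only [affineFrame, h0, h1, h2, h4]

/-- `G` is the affine group of the cube, described by the affinely independent quadruples. -/
def affineModel : FrameModel G (ℕ × ℕ × ℕ × ℕ) where
  frames := affineFrames
  nodup := by
    have h : cubePoints.Nodup := by decide
    exact (h.product (h.product (h.product h))).filter _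
  base := [0, 1, 2, 4]
  act := affineAct
  frame := affineFrame
  frame_mem := affineFrame_mem
  act_frame := affineAct_frame
  base_lt := by decide
  frame_ext g h hgh := Subtype.ext (Equiv.ext fun x => Fin.ext (by
    rw [← affineAct_frame, ← affineAct_frame, affineFrame, affineFrame, hgh 0 (by decide),
      hgh 1 (by decide), hgh 2 (by decide), hgh 4 (by decide)]))
  exists_of_mem := exists_affineFrame_eq

lemma natCard_G : Nat.card G = 1344 := by
  rw [affineModel.nat_card]
  decide +kernel

noncomputable instance : Fintype G := Fintype.ofFinite G

/-- The action of `G` on the translations of the cube. -/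
def linearPart : G →* Equiv.Perm (Fin 8) :=
  MonoidHom.toHomPerm
    { toFun := fun g x => g.1 x ^^^ g.1 0
      map_one' := by
        funext x
        revert x
        decide
      map_mul' := fun g h => by
        funext x
        -- Inserting a summand 0 makes affinity applicable to a sum of two points; the two copies of
        -- `g.1 0` then cancel.
        have key : ∀ x y z : Fin 8, x ^^^ y ^^^ 0 = x ^^^ y ∧ x ^^^ y ^^^ z ^^^ z = x ^^^ y := by
          decide +kernel
        change g.1 (h.1 x) ^^^ g.1 (h.1 0) = g.1 (h.1 x ^^^ h.1 0) ^^^ g.1 0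
        rw [← (key (h.1 x) (h.1 0) 0).1, G_affine g.2, (key _ _ _).2] }

/-- The images of `0, 1, 2, 4` under representatives of the conjugacy classes of `G`. -/
def framesG : Fin 11 → ℕ × ℕ × ℕ × ℕ :=
  ![(0, 1, 2, 4), (0, 2, 4, 3), (0, 5, 1, 2), (0, 1, 2, 5), (0, 1, 3, 6), (0, 1, 4, 6),
    (1, 0, 3, 5), (1, 0, 3, 6), (1, 0, 4, 6), (1, 2, 3, 5), (1, 2, 4, 0)]

/-- The orders of the centralizers in `G`. -/
def centralizersG : Fin 11 → ℕ := ![1344, 7, 7, 32, 8, 6, 192, 32, 6, 16, 8]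

/-- The numbers of fixed points in the cube. -/
def fixedG : Fin 11 → ℕ := ![8, 1, 1, 4, 2, 2, 0, 0, 0, 0, 0]

/-- The rational part of the character table of `G`. -/
def tableG : Fin 11 → Fin 11 → ℤ :=
  ![![1, 1, 1, 1, 1, 1, 1, 1, 1, 1, 1],
    ![3, -1, 0, -1, 1, 0, 3, -1, 0, -1, 1],
    ![3, 0, -1, -1, 1, 0, 3, -1, 0, -1, 1],
    ![6, -1, -1, 2, 0, 0, 6, 2, 0, 2, 0],
    ![7, 0, 0, -1, -1, 1, 7, -1, 1, -1, -1],
    ![8, 1, 1, 0, 0, -1, 8, 0, -1, 0, 0],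
    ![7, 0, 0, -1, -1, 1, -1, 3, -1, -1, 1],
    ![7, 0, 0, 3, 1, 1, -1, -1, -1, -1, -1],
    ![14, 0, 0, 2, 0, -1, -2, 2, 1, -2, 0],
    ![21, 0, 0, -3, 1, 0, -3, 1, 0, 1, -1],
    ![21, 0, 0, 1, -1, 0, -3, -3, 0, 1, 1]]

lemma framesG_mem : ∀ i, framesG i ∈ affineModel.frames := by decide +kernel

lemma transporterCount_framesG :
    ∀ i, affineModel.transporterCount (framesG i) (framesG i) = centralizersG i := by
  decide +kernel

/-- The conjugacy classes of `G`. -/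
noncomputable def classesG : ClassData G :=
  -- The frame `y` belongs to an element that conjugates the square of the representative 1 to that
  -- representative.
  affineModel.classData framesG_mem (N := centralizersG) (fix := fixedG) (y := (0, 1, 6, 2))
    (by decide +kernel) transporterCount_framesG (by decide +kernel) (by decide +kernel)
    (by decide +kernel) (by decide +kernel) (by decide +kernel) (by decide +kernel)
    (by decide +kernel) (by decide +kernel)

end AffineGroup

/-! ### The character table and the multiplicities for `G`. -/

section AffineTable

lemma classesG_card_fixed (j : Fin 11) :
    (Finset.univ.filter fun x : Fin 8 => (classesG.rep j).1 x = x).card = fixedG j := by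
  have h : ∀ j, (Finset.univ.filter fun x : Fin 8 => affineAct (framesG j) x = x).card =
      fixedG j := by decide +kernel
  exact (affineModel.card_fixed_elt _ (framesG_mem j)).trans (h j)

lemma classesG_card_fixed_sq (j : Fin 11) :
    (Finset.univ.filter fun x : Fin 8 => (classesG.rep j ^ 2).1 x = x).card =
      ![8, 1, 1, 8, 4, 2, 8, 8, 2, 0, 0] j := by
  have h : ∀ j, (Finset.univ.filter fun x : Fin 8 => (affineAct (framesG j))^[2] x = x).card =
      ![8, 1, 1, 8, 4, 2, 8, 8, 2, 0, 0] j := by decide +kernel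
  exact (affineModel.card_fixed_elt_pow _ (framesG_mem j) 2).trans (h j)

lemma card_fixed_linearPart_elt_pow (t : ℕ × ℕ × ℕ × ℕ) (ht : t ∈ affineModel.frames) (m : ℕ) :
    (Finset.univ.filter fun x : Fin 8 => linearPart (affineModel.elt t ht ^ m) x = x).card =
      (Finset.univ.filter fun x : Fin 8 => Fin.ofNat 8 ((affineAct t)^[m] x) ^^^
        Fin.ofNat 8 ((affineAct t)^[m] 0) = x).card := by
  congr 1
  refine Finset.filter_congr fun x _ => ?_
  change (affineModel.elt t ht ^ m).1 x ^^^ (affineModel.elt t ht ^ m).1 0 = x ↔ _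
  rw [affineModel.elt_pow_apply_eq_ofNat, affineModel.elt_pow_apply_eq_ofNat]
  rfl

lemma classesG_card_fixed_linearPart (j : Fin 11) :
    (Finset.univ.filter fun x : Fin 8 => linearPart (classesG.rep j) x = x).card =
      ![8, 1, 1, 4, 2, 2, 8, 4, 2, 4, 2] j := by
  have h : ∀ j, (Finset.univ.filter fun x : Fin 8 => Fin.ofNat 8 ((affineAct (framesG j))^[1] x) ^^^
      Fin.ofNat 8 ((affineAct (framesG j))^[1] 0) = x).card =
      ![8, 1, 1, 4, 2, 2, 8, 4, 2, 4, 2] j := by decide +kernel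
  rw [← pow_one (classesG.rep j)]
  exact (card_fixed_linearPart_elt_pow _ (framesG_mem j) 1).trans (h j)

lemma classesG_card_fixed_linearPart_sq (j : Fin 11) :
    (Finset.univ.filter fun x : Fin 8 => linearPart (classesG.rep j ^ 2) x = x).card =
      ![8, 1, 1, 8, 4, 2, 8, 8, 2, 8, 4] j := by
  have h : ∀ j, (Finset.univ.filter fun x : Fin 8 => Fin.ofNat 8 ((affineAct (framesG j))^[2] x) ^^^
      Fin.ofNat 8 ((affineAct (framesG j))^[2] 0) = x).card =
      ![8, 1, 1, 8, 4, 2, 8, 8, 2, 8, 4] j := by decide +kernel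
  exact (card_fixed_linearPart_elt_pow _ (framesG_mem j) 2).trans (h j)

/-- The rational irreducible characters of `G` are polynomials in the two permutation characters
and their exterior squares. -/
lemma exists_hasValues_tableG (i : Fin 11) (h1 : i ≠ 1) (h2 : i ≠ 2) :
    ∃ f, classesG.HasValues f (tableG i) := by
  have hV : classesG.HasValues
      (fun g => ((Finset.univ.filter fun x : Fin 8 => g.1 x = x).card : ℂ))
      (fun j => (fixedG j : ℤ)) :=
    ⟨card_fixed_mem_virtualCharacters G.subtype, fun j => by simp [classesG_card_fixed]⟩
  have hW : classesG.HasValues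
      (fun g => ((Finset.univ.filter fun x : Fin 8 => linearPart g x = x).card : ℂ))
      (fun j => ((![8, 1, 1, 4, 2, 2, 8, 4, 2, 4, 2] j : ℕ) : ℤ)) :=
    ⟨card_fixed_mem_virtualCharacters linearPart, fun j => by
      simp only [classesG_card_fixed_linearPart, Int.cast_natCast]⟩
  -- Degree 7 is the cube without its constant functions. Degree 6 comes from the linear action,
  -- which has the two orbits of zero and the non-zero vectors, so the trivial character is removed
  -- twice.
  have hh := (hV.sub .one).congr (b := tableG 7) (by decide)
  have hd := ((hW.sub .one).sub .one).congr (b := tableG 3) (by decide)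
  have hl := hh.extSquare (b := fun j => ((![8, 1, 1, 8, 4, 2, 8, 8, 2, 0, 0] j : ℕ) : ℤ) - 1)
    (c := tableG 10) (fun j => by
      simp only [Pi.sub_apply, Pi.one_apply, classesG_card_fixed_sq, Int.cast_sub,
        Int.cast_natCast, Int.cast_one]) (by decide)
  have hsq := hd.extSquare (b := fun j => ((![8, 1, 1, 8, 4, 2, 8, 8, 2, 8, 4] j : ℕ) : ℤ) - 1 - 1)
    (c := tableG 4 + tableG 5) (fun j => by
      simp only [Pi.sub_apply, Pi.one_apply, classesG_card_fixed_linearPart_sq, Int.cast_sub,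
        Int.cast_natCast, Int.cast_one]) (by decide)
  have hi := (((hd.mul hh).sub hh).sub hl).congr (b := tableG 8) (by decide)
  -- The tensor square minus the exterior square is the symmetric square, of degree 21, which is `1
  -- + 2 * 6 + 8`; removing the degree 8 row from the exterior square leaves degree 7.
  have hf := (((((hd.mul hd).sub .one).sub hd).sub hd).sub hsq).congr (b := tableG 5) (by decide)
  have he := (hsq.sub hf).congr (b := tableG 4) (by decide)
  have hj := (((hf.mul hh).sub hi).sub hl).congr (b := tableG 9) (by decide)
  have hg := (((he.mul hh).sub hj).sub hl).congr (b := tableG 6) (by decide)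
  fin_cases i
  · exact ⟨_, ClassData.HasValues.one.congr (by decide)⟩
  · exact (h1 rfl).elim
  · exact (h2 rfl).elim
  · exact ⟨_, hd⟩
  · exact ⟨_, he⟩
  · exact ⟨_, hf⟩
  · exact ⟨_, hg⟩
  · exact ⟨_, hh⟩
  · exact ⟨_, hi⟩
  · exact ⟨_, hj⟩
  · exact ⟨_, hl⟩

theorem exists_centralizerAlgebra_G_algEquiv {k : ℕ} (hk : 1 ≤ k) :
    ∃ d : Fin 11 → ℕ, (∀ i, (d i : ℚ) = blocksG k i) ∧
      Nonempty (centralizerAlgebra G k ≃ₐ[ℂ] MultiMatrix d) := by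
  obtain ⟨d, hd, e⟩ := classesG.exists_algEquiv_of_rational_rows (A := tableG)
    (N := centralizersG) rfl rfl rfl rfl natCard_G exists_hasValues_tableG (by decide) (by decide)
    (by decide) (by decide +kernel) (by decide +kernel) (by decide +kernel) (by decide +kernel)
    (tensorPowerRep (ofMulAction ℂ G (Fin 8)) k) (χ := fun j => fixedG j ^ k)
    (fun j => by rw [tensorPowerRep_character, classesG_card_fixed, Nat.cast_pow]) rfl
  refine ⟨d, fun i => (hd i).trans ?_, e⟩
  have h4 : (4 : ℚ) ^ k = 2 ^ (2 * k) := by rw [pow_mul]; norm_num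
  have h8 : (8 : ℚ) ^ k = 2 ^ (3 * k) := by rw [pow_mul]; norm_num
  -- This is where `1 ≤ k` enters: the classes without fixed points drop out of the multiplicities.
  have h0 : (0 : ℚ) ^ k = 0 := zero_pow (by omega)
  have hs : ∀ j : Fin 11, Equiv.swap 1 2 j = ![0, 2, 1, 3, 4, 5, 6, 7, 8, 9, 10] j := by decide
  simp only [hs]
  fin_cases i <;>
    simp [Fin.sum_univ_succ, centralizersG, fixedG, tableG, blocksG, aG, bG, cG, dG, eG, fG, gG,
      hG, iG, jG, lG, h4, h8, h0] <;> ring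

end AffineTable

/-! ### `H` as the group of signed permutations of the octonion units that respect products. -/

section OctonionGroup

/-- The product of the imaginary octonion units, the unit `e_i` being `i` and its negative being
`13 - i`, for `i < 7`. -/
def octMul (x y : ℕ) : ℕ :=
  let i := min x (13 - x)
  let k := (min y (13 - y) + 7 - i) % 7
  -- By Euler's criterion `ε` is 1 exactly when the index difference `k` is a non-square modulo
  -- seven. For square `k` the product of `e_i` and `e_{i+k}` is `e_{i+3k}`; anticommutativity makes
  -- it `-e_{i+5k}` for non-square `k`.
  let ε := k ^ 3 % 7 / 6
  let r := (i + (3 + 2 * ε) * k) % 7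
  bif Nat.beq ((x / 7 + y / 7 + ε) % 2) 0 then r else 13 - r

/-- The product of two units that are neither equal nor opposite. -/
def unitMul (x y : Fin 14) : Fin 14 := Fin.ofNat 14 (octMul x y)

lemma H_rev {g : Equiv.Perm (Fin 14)} (hg : g ∈ H) (x : Fin 14) : g x.rev = (g x).rev := by
  induction hg using Subgroup.closure_induction generalizing x with
  | mem g hg =>
    simp only [Set.mem_insert_iff, Set.mem_singleton_iff] at hg
    rcases hg with rfl | rfl <;> revert x <;> decide +kernel
  | one => rfl
  | mul a b _ _ ha hb => simp only [Equiv.Perm.mul_apply, hb, ha]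
  | inv a _ ha =>
    apply a.injective
    simp only [ha, Equiv.Perm.inv_def, Equiv.apply_symm_apply]

/-- Checked on the generators. Equal or opposite units are excluded because their product is real;
commuting with negation carries this exclusion through products and inverses. -/
lemma H_unitMul {g : Equiv.Perm (Fin 14)} (hg : g ∈ H) (x y : Fin 14) (hxy : x ≠ y)
    (hxy' : x ≠ y.rev) : g (unitMul x y) = unitMul (g x) (g y) := by
  induction hg using Subgroup.closure_induction generalizing x y with
  | mem g hg =>
    simp only [Set.mem_insert_iff, Set.mem_singleton_iff] at hg
    rcases hg with rfl | rfl <;> revert x y <;> decide +kernel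
  | one => rfl
  | mul a b _ hb' ha hb =>
    simp only [Equiv.Perm.mul_apply]
    rw [hb x y hxy hxy', ha _ _ (b.injective.ne hxy)]
    rw [← H_rev hb']
    exact b.injective.ne hxy'
  | inv a ha' ha =>
    apply a.injective
    rw [ha _ _ ((a⁻¹).injective.ne hxy)]
    · simp only [Equiv.Perm.inv_def, Equiv.apply_symm_apply]
    · rw [← H_rev (inv_mem ha')]
      exact (a⁻¹).injective.ne hxy'

/-- The value at `x` of the automorphism of the octonion units that sends the first three units to
the entries of `t`. -/
def octAct (t : ℕ × ℕ × ℕ) (x : ℕ) : ℕ :=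
  let i := min x (13 - x)
  let r := bif Nat.ble i 2 then
      (bif Nat.beq i 0 then t.1 else bif Nat.beq i 1 then t.2.1 else t.2.2)
    else bif Nat.ble i 4 then
      (bif Nat.beq i 3 then octMul t.1 t.2.1 else octMul t.2.1 t.2.2)
    else bif Nat.beq i 5 then octMul t.2.2 (octMul t.1 t.2.1) else octMul t.1 t.2.2
  bif Nat.ble x 6 then r else 13 - r

/-- The entries of `t` generate the octonion units. -/
def octGood (t : ℕ × ℕ × ℕ) : Bool :=
  let i := min t.1 (13 - t.1)
  let j := min t.2.1 (13 - t.2.1)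
  let k := min t.2.2 (13 - t.2.2)
  !Nat.beq i j && (!Nat.beq i k && (!Nat.beq j k &&
    (!Nat.beq (octMul t.1 t.2.1) t.2.2 && !Nat.beq (octMul t.1 t.2.1) (13 - t.2.2))))

/-- The imaginary octonion units. -/
def octUnits : List ℕ := [0, 1, 2, 3, 4, 5, 6, 7, 8, 9, 10, 11, 12, 13]

/-- The generating triples of octonion units. -/
def octFrames : List (ℕ × ℕ × ℕ) := (octUnits ×ˢ octUnits ×ˢ octUnits).filter octGood

/-- The images of the first three units. -/
def octFrame (g : H) : ℕ × ℕ × ℕ := (g.1 0, g.1 1, g.1 2)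

/-- The units 0, 1, 2 generate the others: 3 is `0 * 1`, 4 is `1 * 2`, 5 is `2 * 3` and 6 is `0 *
2`, and the rest are negatives. -/
lemma octAct_frame (g : H) (x : Fin 14) : octAct (octFrame g) x = (g.1 x : ℕ) := by
  have key : ∀ a b c x : Fin 14, octAct (a, b, c) x =
      (![a, b, c, unitMul a b, unitMul b c, unitMul c (unitMul a b), unitMul a c,
        (unitMul a c).rev, (unitMul c (unitMul a b)).rev, (unitMul b c).rev, (unitMul a b).rev,
        c.rev, b.rev, a.rev] x : Fin 14) := by
    decide +kernel
  rw [octFrame, key, ← H_unitMul g.2 0 1 (by decide) (by decide),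
    ← H_unitMul g.2 1 2 (by decide) (by decide), ← H_unitMul g.2 0 2 (by decide) (by decide),
    ← H_unitMul g.2 2 (unitMul 0 1) (by decide) (by decide)]
  simp only [← H_rev g.2]
  fin_cases x <;> rfl

lemma octFrame_mem (g : H) : octFrame g ∈ octFrames := by
  have hmem : ∀ x : Fin 14, (x : ℕ) ∈ octUnits := by decide
  have key : ∀ a b c : Fin 14, (a ≠ b ∧ a ≠ c ∧ b ≠ c ∧ a ≠ b.rev ∧ a ≠ c.rev ∧ b ≠ c.rev ∧
      unitMul a b ≠ c ∧ unitMul a b ≠ c.rev) → octGood (a, b, c) = true := by decide +kernel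
  have hne : ∀ x y : Fin 14, x ≠ y → g.1 x ≠ g.1 y := fun x y h => g.1.injective.ne h
  refine List.mem_filter.2 ⟨?_, key _ _ _ ?_⟩
  · exact List.mem_product.2 ⟨hmem _, List.mem_product.2 ⟨hmem _, hmem _⟩⟩
  · rw [← H_unitMul g.2 0 1 (by decide) (by decide)]
    simp only [← H_rev g.2]
    exact ⟨hne _ _ (by decide), hne _ _ (by decide), hne _ _ (by decide), hne _ _ (by decide),
      hne _ _ (by decide), hne _ _ (by decide), hne _ _ (by decide), hne _ _ (by decide)⟩

/-- The generators of `H`. -/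
def gensH : List (Equiv.Perm (Fin 14)) :=
  [[0, 1, 2, 3, 4, 5, 6].formPerm * [13, 12, 11, 10, 9, 8, 7].formPerm,
   [0, 3, 6, 8, 13, 10, 7, 5].formPerm * [1, 4, 12, 9].formPerm]

lemma word_gensH_mem (w : List ℕ) : word gensH w ∈ H := by
  refine word_mem (fun g hg => Subgroup.subset_closure ?_) w
  simpa [gensH] using hg

/-- First link of a stabilizer chain through the units 0, 1, 2, with 14, 12 and 8 admissible points
and one word for each. -/
lemma H_exists_zero (x : Fin 14) : ∃ g ∈ H, g x = 0 := by
  have h : ∀ x : Fin 14, ∃ w ∈ [[], [1, 0, 1], [0, 1, 0], [0, 1], [1, 0], [1], [0], [1, 1],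
      [1, 1, 0], [1, 1, 0, 0], [1, 1, 1], [1, 1, 1, 0], [1, 1, 1, 0, 0], [1, 1, 1, 1]],
      word gensH w x = 0 := by decide +kernel
  obtain ⟨w, -, hw⟩ := h x
  exact ⟨_, word_gensH_mem w, hw⟩

lemma H_exists_one (x : Fin 14) (h0 : x ≠ 0) (h0' : x ≠ Fin.rev 0) :
    ∃ g ∈ H, g 0 = 0 ∧ g x = 1 := by
  have h : ∀ x : Fin 14, x ≠ 0 → x ≠ Fin.rev 0 → ∃ w ∈ [[], [0, 1, 0, 0, 0], [0, 1, 1, 0, 1, 1],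
      [0, 1, 1, 1, 0, 0, 1], [0, 0, 0, 0, 0, 1, 0, 0], [0, 1, 0, 1, 0, 0], [0, 1, 1],
      [0, 0, 0, 1, 0], [1, 1, 0, 0, 1, 1, 1, 0], [1, 1, 0, 0, 1, 1, 0, 1], [1, 0, 0, 1],
      [0, 1, 1, 1, 0, 1, 0]], word gensH w 0 = 0 ∧ word gensH w x = 1 := by decide +kernel
  obtain ⟨w, -, hw⟩ := h x h0 h0'
  exact ⟨_, word_gensH_mem w, hw⟩

lemma H_exists_two (x : Fin 14) (hx : x ≠ 0 ∧ x ≠ Fin.rev 0 ∧ x ≠ 1 ∧ x ≠ Fin.rev 1 ∧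
    x ≠ unitMul 0 1 ∧ x ≠ (unitMul 0 1).rev) : ∃ g ∈ H, g 0 = 0 ∧ g 1 = 1 ∧ g x = 2 := by
  have h : ∀ x : Fin 14, (x ≠ 0 ∧ x ≠ Fin.rev 0 ∧ x ≠ 1 ∧ x ≠ Fin.rev 1 ∧
      x ≠ unitMul 0 1 ∧ x ≠ (unitMul 0 1).rev) → ∃ w ∈ [[], [0, 0, 0, 1, 0, 1, 0, 0, 0, 0, 0],
      [1, 0, 0, 1, 0, 1, 0, 0, 0], [1, 1, 1, 1, 1, 1, 1, 0, 0, 0], [0, 0, 0, 0, 1],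
      [1, 1, 1, 0, 0, 1, 1, 0], [1, 0, 0, 1, 0, 1, 1], [0, 0, 1, 1, 0, 1, 0, 1, 1, 0]],
      word gensH w 0 = 0 ∧ word gensH w 1 = 1 ∧ word gensH w x = 2 := by decide +kernel
  obtain ⟨w, -, hw⟩ := h x hx
  exact ⟨_, word_gensH_mem w, hw⟩

/-- `H` is transitive on the generating triples. -/
lemma exists_octFrame_eq (t : ℕ × ℕ × ℕ) (ht : t ∈ octFrames) : ∃ g, octFrame g = t := by
  have key : ∀ a b c : Fin 14, octGood (a, b, c) = true → a ≠ b ∧ a ≠ b.rev ∧ b ≠ a ∧ b ≠ a.rev ∧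
      c ≠ a ∧ c ≠ a.rev ∧ c ≠ b ∧ c ≠ b.rev ∧ c ≠ unitMul a b ∧ c ≠ (unitMul a b).rev := by
    decide +kernel
  have hlt : ∀ x ∈ octUnits, x < 14 := by decide
  obtain ⟨a, b, c⟩ := t
  obtain ⟨hm, hgood⟩ := List.mem_filter.1 ht
  obtain ⟨ha, hm⟩ := List.mem_product.1 hm
  obtain ⟨hb, hc⟩ := List.mem_product.1 hm
  lift a to Fin 14 using hlt a ha
  lift b to Fin 14 using hlt b hb
  lift c to Fin 14 using hlt c hc
  obtain ⟨hab, hab', hba, hba', hca, hca', hcb, hcb', hcm, hcm'⟩ := key a b c hgood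
  obtain ⟨g₁, m₁, e₁⟩ := H_exists_zero a
  obtain ⟨g₂, m₂, e₂, e₂'⟩ := H_exists_one (g₁ b) (e₁ ▸ g₁.injective.ne hba)
    (by rw [← e₁, ← H_rev m₁]; exact g₁.injective.ne hba')
  have m₂₁ := mul_mem m₂ m₁
  set h₂ := g₂ * g₁
  have ea : h₂ a = 0 := by rw [Equiv.Perm.mul_apply, e₁, e₂]
  have eb : h₂ b = 1 := e₂'
  obtain ⟨g₃, m₃, e₃, e₃', e₃''⟩ := H_exists_two (h₂ c) (by
    rw [← ea, ← eb, ← H_unitMul m₂₁ a b hab hab', ← H_rev m₂₁, ← H_rev m₂₁, ← H_rev m₂₁]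
    exact ⟨h₂.injective.ne hca, h₂.injective.ne hca', h₂.injective.ne hcb, h₂.injective.ne hcb',
      h₂.injective.ne hcm, h₂.injective.ne hcm'⟩)
  refine ⟨⟨(g₃ * h₂)⁻¹, inv_mem (mul_mem m₃ m₂₁)⟩, ?_⟩
  have h0 : (g₃ * h₂)⁻¹ 0 = a := by rw [Equiv.Perm.inv_eq_iff_eq, Equiv.Perm.mul_apply, ea, e₃]
  have h1 : (g₃ * h₂)⁻¹ 1 = b := by rw [Equiv.Perm.inv_eq_iff_eq, Equiv.Perm.mul_apply, eb, e₃']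
  have h2 : (g₃ * h₂)⁻¹ 2 = c := by rw [Equiv.Perm.inv_eq_iff_eq, Equiv.Perm.mul_apply, e₃'']
  simp only [octFrame, h0, h1, h2]

/-- `H` is the automorphism group of the octonion units, described by the generating triples. -/
def octModel : FrameModel H (ℕ × ℕ × ℕ) where
  frames := octFrames
  nodup := by
    have h : octUnits.Nodup := by decide
    exact (h.product (h.product h)).filter _
  base := [0, 1, 2]
  act := octAct
  frame := octFrame
  frame_mem := octFrame_mem
  act_frame := octAct_frame
  base_lt := by decide
  frame_ext g h hgh := Subtype.ext (Equiv.ext fun x => Fin.ext (by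
    rw [← octAct_frame, ← octAct_frame, octFrame, octFrame, hgh 0 (by decide),
      hgh 1 (by decide), hgh 2 (by decide)]))
  exists_of_mem := exists_octFrame_eq

lemma natCard_H : Nat.card H = 1344 := by
  rw [octModel.nat_card]
  decide +kernel

noncomputable instance : Fintype H := Fintype.ofFinite H

/-- The pair of opposite units that contains a given unit. -/
def unitLine (x : Fin 14) : Fin 7 := Fin.ofNat 7 (min x (13 - x))

/-- The action of `H` on the pairs of opposite units. -/
def lineAction : H →* Equiv.Perm (Fin 7) :=
  MonoidHom.toHomPerm
    { toFun := fun g i => unitLine (g.1 (i.castLE (by decide)))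
      map_one' := by
        funext i
        revert i
        decide
      map_mul' := fun g h => by
        funext i
        -- The chosen representative of a line differs from the given unit at most by a sign, which
        -- `H_rev` carries through `g`.
        have key : ∀ x : Fin 14, (unitLine x).castLE (by decide) = x ∨
            (unitLine x).castLE (by decide) = x.rev := by decide
        have hrev : ∀ x : Fin 14, unitLine x.rev = unitLine x := by decide
        change unitLine (g.1 (h.1 _)) = unitLine (g.1 ((unitLine (h.1 _)).castLE _))
        rcases key (h.1 (i.castLE (by decide))) with e | e <;> rw [e]
        rw [H_rev g.2, hrev] }

/-- The images of the first three units under representatives of the conjugacy classes of `H`. -/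
def framesH : Fin 11 → ℕ × ℕ × ℕ :=
  ![(0, 1, 2), (1, 2, 3), (6, 0, 1), (0, 1, 4), (0, 1, 11), (0, 2, 1), (0, 2, 3), (0, 2, 4),
    (0, 3, 6), (1, 0, 4), (1, 2, 13)]

/-- The orders of the centralizers in `H`. -/
def centralizersH : Fin 11 → ℕ := ![1344, 7, 7, 32, 192, 16, 8, 6, 32, 8, 6]

/-- The numbers of fixed units. -/
def fixedH : Fin 11 → ℕ := ![14, 0, 0, 6, 6, 2, 2, 2, 2, 0, 0]

/-- The rational part of the character table of `H`. -/
def tableH : Fin 11 → Fin 11 → ℤ :=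
  ![![1, 1, 1, 1, 1, 1, 1, 1, 1, 1, 1],
    ![3, -1, 0, -1, 3, -1, 1, 0, -1, 1, 0],
    ![3, 0, -1, -1, 3, -1, 1, 0, -1, 1, 0],
    ![6, -1, -1, 2, 6, 2, 0, 0, 2, 0, 0],
    ![7, 0, 0, -1, 7, -1, -1, 1, -1, -1, 1],
    ![8, 1, 1, 0, 8, 0, 0, -1, 0, 0, -1],
    ![7, 0, 0, 3, -1, -1, 1, 1, -1, -1, -1],
    ![7, 0, 0, -1, -1, -1, -1, 1, 3, 1, -1],
    ![14, 0, 0, 2, -2, -2, 0, -1, 2, 0, 1],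
    ![21, 0, 0, 1, -3, 1, -1, 0, -3, 1, 0],
    ![21, 0, 0, -3, -3, 1, 1, 0, 1, -1, 0]]

lemma framesH_mem : ∀ i, framesH i ∈ octModel.frames := by decide +kernel

lemma transporterCount_framesH :
    ∀ i, octModel.transporterCount (framesH i) (framesH i) = centralizersH i := by
  decide +kernel

/-- The conjugacy classes of `H`. -/
noncomputable def classesH : ClassData H :=
  octModel.classData framesH_mem (N := centralizersH) (fix := fixedH) (y := (0, 4, 1))
    (by decide +kernel) transporterCount_framesH (by decide +kernel) (by decide +kernel)
    (by decide +kernel) (by decide +kernel) (by decide +kernel) (by decide +kernel)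
    (by decide +kernel) (by decide +kernel)

end OctonionGroup

/-! ### The character table and the multiplicities for `H`. -/

section OctonionTable

lemma classesH_card_fixed (j : Fin 11) :
    (Finset.univ.filter fun x : Fin 14 => (classesH.rep j).1 x = x).card = fixedH j := by
  have h : ∀ j, (Finset.univ.filter fun x : Fin 14 => octAct (framesH j) x = x).card =
      fixedH j := by decide +kernel
  exact (octModel.card_fixed_elt _ (framesH_mem j)).trans (h j)

lemma classesH_card_fixed_sq (j : Fin 11) :
    (Finset.univ.filter fun x : Fin 14 => (classesH.rep j ^ 2).1 x = x).card =
      ![14, 0, 0, 6, 14, 14, 2, 2, 6, 6, 2] j := by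
  have h : ∀ j, (Finset.univ.filter fun x : Fin 14 => (octAct (framesH j))^[2] x = x).card =
      ![14, 0, 0, 6, 14, 14, 2, 2, 6, 6, 2] j := by decide +kernel
  exact (octModel.card_fixed_elt_pow _ (framesH_mem j) 2).trans (h j)

lemma card_fixed_lineAction_elt_pow (t : ℕ × ℕ × ℕ) (ht : t ∈ octModel.frames) (m : ℕ) :
    (Finset.univ.filter fun i : Fin 7 => lineAction (octModel.elt t ht ^ m) i = i).card =
      (Finset.univ.filter fun i : Fin 7 =>
        unitLine (Fin.ofNat 14 ((octAct t)^[m] i)) = i).card := by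
  congr 1
  refine Finset.filter_congr fun i _ => ?_
  change unitLine ((octModel.elt t ht ^ m).1 (i.castLE _)) = i ↔ _
  rw [octModel.elt_pow_apply_eq_ofNat]
  rfl

lemma classesH_card_fixed_lineAction (j : Fin 11) :
    (Finset.univ.filter fun i : Fin 7 => lineAction (classesH.rep j) i = i).card =
      ![7, 0, 0, 3, 7, 3, 1, 1, 3, 1, 1] j := by
  have h : ∀ j, (Finset.univ.filter fun i : Fin 7 =>
      unitLine (Fin.ofNat 14 ((octAct (framesH j))^[1] i)) = i).card =
      ![7, 0, 0, 3, 7, 3, 1, 1, 3, 1, 1] j := by decide +kernel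
  rw [← pow_one (classesH.rep j)]
  exact (card_fixed_lineAction_elt_pow _ (framesH_mem j) 1).trans (h j)

lemma classesH_card_fixed_lineAction_sq (j : Fin 11) :
    (Finset.univ.filter fun i : Fin 7 => lineAction (classesH.rep j ^ 2) i = i).card =
      ![7, 0, 0, 7, 7, 7, 3, 1, 7, 3, 1] j := by
  have h : ∀ j, (Finset.univ.filter fun i : Fin 7 =>
      unitLine (Fin.ofNat 14 ((octAct (framesH j))^[2] i)) = i).card =
      ![7, 0, 0, 7, 7, 7, 3, 1, 7, 3, 1] j := by decide +kernel
  exact (card_fixed_lineAction_elt_pow _ (framesH_mem j) 2).trans (h j)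

/-- The rational irreducible characters of `H` are polynomials in the two permutation characters
and their exterior squares. -/
lemma exists_hasValues_tableH (i : Fin 11) (h1 : i ≠ 1) (h2 : i ≠ 2) :
    ∃ f, classesH.HasValues f (tableH i) := by
  have hV : classesH.HasValues
      (fun g => ((Finset.univ.filter fun x : Fin 14 => g.1 x = x).card : ℂ))
      (fun j => (fixedH j : ℤ)) :=
    ⟨card_fixed_mem_virtualCharacters H.subtype, fun j => by simp [classesH_card_fixed]⟩
  have hW : classesH.HasValues
      (fun g => ((Finset.univ.filter fun i : Fin 7 => lineAction g i = i).card : ℂ))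
      (fun j => ((![7, 0, 0, 3, 7, 3, 1, 1, 3, 1, 1] j : ℕ) : ℤ)) :=
    ⟨card_fixed_mem_virtualCharacters lineAction, fun j => by
      simp only [classesH_card_fixed_lineAction, Int.cast_natCast]⟩
  -- Functions on the units split into even ones, which are functions on the seven lines, and odd
  -- ones; these give the degrees `1 + 6` and 7. The exterior square of the odd part splits as `7 +
  -- 14`, with the odd part itself as a summand.
  have hd := (hW.sub .one).congr (b := tableH 3) (by decide)
  have hg := (hV.sub hW).congr (b := tableH 6) (by decide)
  have hdsq := hd.extSquare (b := fun j => ((![7, 0, 0, 7, 7, 7, 3, 1, 7, 3, 1] j : ℕ) : ℤ) - 1)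
    (c := tableH 4 + tableH 5) (fun j => by
      simp only [Pi.sub_apply, Pi.one_apply, classesH_card_fixed_lineAction_sq, Int.cast_sub,
        Int.cast_natCast, Int.cast_one]) (by decide)
  have hgsq := hg.extSquare (b := fun j => ((![14, 0, 0, 6, 14, 14, 2, 2, 6, 6, 2] j : ℕ) : ℤ) -
      (![7, 0, 0, 7, 7, 7, 3, 1, 7, 3, 1] j : ℕ))
    (c := tableH 6 + tableH 8) (fun j => by
      simp only [Pi.sub_apply, classesH_card_fixed_sq, classesH_card_fixed_lineAction_sq,
        Int.cast_sub, Int.cast_natCast]) (by decide)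
  have hf := (((((hd.mul hd).sub .one).sub hd).sub hd).sub hdsq).congr (b := tableH 5) (by decide)
  have he := (hdsq.sub hf).congr (b := tableH 4) (by decide)
  have hi := (hgsq.sub hg).congr (b := tableH 8) (by decide)
  have hj := (((hd.mul hg).sub hg).sub hi).congr (b := tableH 9) (by decide)
  have hl := (((hf.mul hg).sub hi).sub hj).congr (b := tableH 10) (by decide)
  have hh := (((he.mul hg).sub hj).sub hl).congr (b := tableH 7) (by decide)
  fin_cases i
  · exact ⟨_, ClassData.HasValues.one.congr (by decide)⟩
  · exact (h1 rfl).elim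
  · exact (h2 rfl).elim
  · exact ⟨_, hd⟩
  · exact ⟨_, he⟩
  · exact ⟨_, hf⟩
  · exact ⟨_, hg⟩
  · exact ⟨_, hh⟩
  · exact ⟨_, hi⟩
  · exact ⟨_, hj⟩
  · exact ⟨_, hl⟩

theorem exists_centralizerAlgebra_H_algEquiv {k : ℕ} (hk : 1 ≤ k) :
    ∃ d : Fin 11 → ℕ, (∀ i, (d i : ℚ) = blocksH k i) ∧
      Nonempty (centralizerAlgebra H k ≃ₐ[ℂ] MultiMatrix d) := by
  obtain ⟨d, hd, e⟩ := classesH.exists_algEquiv_of_rational_rows (A := tableH)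
    (N := centralizersH) rfl rfl rfl rfl natCard_H exists_hasValues_tableH (by decide) (by decide)
    (by decide) (by decide +kernel) (by decide +kernel) (by decide +kernel) (by decide +kernel)
    (tensorPowerRep (ofMulAction ℂ H (Fin 14)) k) (χ := fun j => fixedH j ^ k)
    (fun j => by rw [tensorPowerRep_character, classesH_card_fixed, Nat.cast_pow]) rfl
  refine ⟨d, fun i => (hd i).trans ?_, e⟩
  have h6 : (6 : ℚ) ^ k = 2 ^ k * 3 ^ k := by rw [← mul_pow]; norm_num
  have h14 : (14 : ℚ) ^ k = 2 ^ k * 7 ^ k := by rw [← mul_pow]; norm_num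
  have h0 : (0 : ℚ) ^ k = 0 := zero_pow (by omega)
  have hs : ∀ j : Fin 11, Equiv.swap 1 2 j = ![0, 2, 1, 3, 4, 5, 6, 7, 8, 9, 10] j := by decide
  simp only [hs]
  fin_cases i <;>
    simp [Fin.sum_univ_succ, centralizersH, fixedH, tableH, blocksH, aH, bH, cH, dH, eH, fH, gH,
      hH, iH, jH, lH, h6, h14, h0] <;> ring

end OctonionTable

end Order1344

/-! ### Assembly, with the explicit case `k = 1`. -/

theorem mainTheorem1 :
    Nat.card Order1344.G = 1344 ∧ Nat.card Order1344.H = 1344 ∧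
    Nonempty (Order1344.centralizerAlgebra Order1344.G 1 ≃ₐ[ℂ]
      Order1344.MultiMatrix fun _ : Fin 2 => 1) ∧
    Nonempty (Order1344.centralizerAlgebra Order1344.H 1 ≃ₐ[ℂ]
      Order1344.MultiMatrix fun _ : Fin 3 => 1) ∧
    ∀ k : ℕ, 1 ≤ k →
      (∃ d : Fin 11 → ℕ, (∀ i, (d i : ℚ) = Order1344.blocksG k i) ∧
        Nonempty (Order1344.centralizerAlgebra Order1344.G k ≃ₐ[ℂ] Order1344.MultiMatrix d)) ∧
      (∃ d : Fin 11 → ℕ, (∀ i, (d i : ℚ) = Order1344.blocksH k i) ∧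
        Nonempty (Order1344.centralizerAlgebra Order1344.H k ≃ₐ[ℂ] Order1344.MultiMatrix d)) := by
  refine ⟨Order1344.natCard_G, Order1344.natCard_H, ?_, ?_, fun k hk =>
    ⟨Order1344.exists_centralizerAlgebra_G_algEquiv hk,
      Order1344.exists_centralizerAlgebra_H_algEquiv hk⟩⟩
  · obtain ⟨d, hd, ⟨e⟩⟩ := Order1344.exists_centralizerAlgebra_G_algEquiv le_rfl
    have hb : ∀ i, Order1344.blocksG 1 i = (![1, 0, 0, 0, 0, 0, 0, 1, 0, 0, 0] i : ℕ) := by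
      decide +kernel
    have hd' : ∀ i, d i = ![1, 0, 0, 0, 0, 0, 0, 1, 0, 0, 0] i := fun i => by
      exact_mod_cast (hd i).trans (hb i)
    -- The constituents are the trivial character and the character of degree 7 in row 7.
    obtain ⟨e'⟩ := Order1344.nonempty_multiMatrix_algEquiv_of_embedding d ![0, 7] (by decide)
      (fun j => by rw [hd']; revert j; decide) (fun i hi => by
        rw [hd']; simp only [Set.mem_range] at hi; revert i; decide)
    exact ⟨e.trans e'⟩
  · obtain ⟨d, hd, ⟨e⟩⟩ := Order1344.exists_centralizerAlgebra_H_algEquiv le_rfl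
    have hb : ∀ i, Order1344.blocksH 1 i = (![1, 0, 0, 1, 0, 0, 1, 0, 0, 0, 0] i : ℕ) := by
      decide +kernel
    have hd' : ∀ i, d i = ![1, 0, 0, 1, 0, 0, 1, 0, 0, 0, 0] i := fun i => by
      exact_mod_cast (hd i).trans (hb i)
    -- The constituents have degrees 1, 6 and 7: the constants, the rest of the functions on lines,
    -- and the odd functions.
    obtain ⟨e'⟩ := Order1344.nonempty_multiMatrix_algEquiv_of_embedding d ![0, 3, 6] (by decide)
      (fun j => by rw [hd']; revert j; decide) (fun i hi => by
        rw [hd']; simp only [Set.mem_range] at hi; revert i; decide)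
    exact ⟨e.trans e'⟩
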